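/- Let $\xi=(\xi_0,\xi_1,\dots)$ be an i.i.d. sequence (the random environment) with values in a measurable space $\Theta$. To each $\theta\in\Theta$ are attached, measurably in $\theta$, two probability distributions on $\mathbb N=\{0,1,2,\dots\}$: the offspring distribution $(p_k(\theta))_{k\ge0}$ and the immigration distribution $(h_k(\theta))_{k\ge0}$. Given $\xi$, let the random variables $X_{n,i}$ ($n\ge0$, $i\ge1$) and $Y_n$ ($n\ge0$) be independent, where $X_{n,i}$ has distribution $(p_k(\xi_n))_k$ and $Y_n$ has distribution $(h_k(\xi_n))_k$. Write $\mathbb P_\xi,\mathbb E_\xi$ for the conditional (quenched) probability and expectation given $\xi$, and $\mathbb P,\mathbb E$ for the total (annealed) ones. The branching process with immigration in the random environment $\xi$ is $$Z_0=1,\qquad Z_{n+1}=Y_n+\sum_{i=1}^{Z_n}X_{n,i}\quad(n\ge0).$$ Put $X_0=X_{0,1}$, $m_n=\sum_{k\ge0}k\,p_k(\xi_n)=\mathbb E_\xi X_{n,1}\in[0,\infty]$, $\Pi_n=\prod_{k=0}^{n-1}m_k$ (with $\Pi_0=1$) and $W_n=Z_n/\Pi_n$. Assume that $\mathbb P(X_0=0)=0$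 and $\mathbb P(X_0=1)<1$ and that, for some $r>1$, $p>1$ and $\delta>0$, $$\mathbb E\Big(\frac{Y_0}{m_0}\Big)^{\delta}<\infty,\qquad \mathbb E(\log m_0)^{r}<\infty,\qquad \mathbb E\Big[\Big(\mathbb E_\xi\Big(\frac{X_0}{m_0}\Big)^{p}\Big)^{\delta}\Big]<\infty.$$ (The second condition includes that $m_0<\infty$ almost surely.) Then $W_n$ converges $\mathbb P$-almost surely to a limit $W$ with $0<W<\infty$ almost surely, the random variables $\log W_n$ ($n\ge0$) and $\log W$ are integrable, and $$\lim_{n\to\infty}\mathbb E\log W_n=\mathbb E\log W,\qquad \lim_{n\to\infty}\mathbb E\,|\log W_n-\log W|=0.$$ -/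

import Mathlib

open MeasureTheory ProbabilityTheory Filter Topology
open scoped ENNReal

/-- A branching process with immigration in an i.i.d. random environment.

* `Θ` is the space of states of the environment at one time and `Γ` the space carrying the quenched
  laws.
* `envLaw` is the common law of the `ξ n`; an environment is a sequence `e : ℕ → Θ`.
* `offspring θ` and `immigration θ` are the two probability distributions on `ℕ` attached to `θ`,
  that is `p_k(θ) = offspring θ {k}` and `h_k(θ) = immigration θ {k}`.
* `quenched e` is the quenched law, a probability measure on `Γ` that is measurable in `e`.
* `X n i` is the number of children of the individual number `i` of generation `n`
  (individuals are numbered from `0`) and `Y n` is the number of immigrants of generation `n`.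

Given (almost) any environment `e`, all the variables `X n i` and `Y n` are independent, with
`X n i` of law `offspring (e n)` and `Y n` of law `immigration (e n)`. -/
structure BPIRE (Θ Γ : Type*) [MeasurableSpace Θ] [MeasurableSpace Γ] where
  envLaw : Measure Θ
  isProbabilityMeasure_envLaw : IsProbabilityMeasure envLaw
  offspring : Kernel Θ ℕ
  isMarkovKernel_offspring : IsMarkovKernel offspring
  immigration : Kernel Θ ℕ
  isMarkovKernel_immigration : IsMarkovKernel immigration
  quenched : Kernel (ℕ → Θ) Γ
  isMarkovKernel_quenched : IsMarkovKernel quenched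
  X : ℕ → ℕ → Γ → ℕ
  measurable_X : ∀ n i, Measurable (X n i)
  Y : ℕ → Γ → ℕ
  measurable_Y : ∀ n, Measurable (Y n)
  map_X : ∀ᵐ e ∂(Measure.infinitePi fun _ : ℕ => envLaw),
    ∀ n i, (quenched e).map (X n i) = offspring (e n)
  map_Y : ∀ᵐ e ∂(Measure.infinitePi fun _ : ℕ => envLaw),
    ∀ n, (quenched e).map (Y n) = immigration (e n)
  indep : ∀ᵐ e ∂(Measure.infinitePi fun _ : ℕ => envLaw),
    iIndepFun (Sum.elim (fun a : ℕ × ℕ => X a.1 a.2) Y) (quenched e)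

namespace BPIRE

attribute [instance] isProbabilityMeasure_envLaw isMarkovKernel_offspring
  isMarkovKernel_immigration isMarkovKernel_quenched

noncomputable section

variable {Θ Γ : Type*} [MeasurableSpace Θ] [MeasurableSpace Γ] (B : BPIRE Θ Γ)

/-- The law `τ` of the whole environment, under which the coordinates `ξ n` are i.i.d. -/
def tau : Measure (ℕ → Θ) := Measure.infinitePi fun _ : ℕ => B.envLaw

/-- The annealed (total) law `P(de, dx) = P_e(dx) τ(de)`. A sample point is `ω = (e, x)`. -/
def annealed : Measure ((ℕ → Θ) × Γ) := B.tau ⊗ₘ B.quenched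

/-- The mean `∑ k, k p_k(θ)` of the offspring distribution, possibly infinite. -/
def mean (θ : Θ) : ℝ≥0∞ := ∑' k : ℕ, (k : ℝ≥0∞) * B.offspring θ {k}

/-- The population size: `Z 0 = 1` and `Z (n + 1) = Y n + ∑ i < Z n, X n i`. -/
def Z : ℕ → Γ → ℕ
  | 0, _ => 1
  | n + 1, x => B.Y n x + ∑ i ∈ Finset.range (Z n x), B.X n i x

/-- The normalization `Π_n = m_0 ⋯ m_{n-1}` with `m_k = mean (e k)`. It is used only where the
`m_k` are almost surely finite. -/
def Pi (n : ℕ) (e : ℕ → Θ) : ℝ := ∏ k ∈ Finset.range n, (B.mean (e k)).toReal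

/-- The normalized population size `W_n = Z_n / Π_n`. -/
def W (n : ℕ) (ω : (ℕ → Θ) × Γ) : ℝ := (B.Z n ω.2 : ℝ) / B.Pi n ω.1

/-- The limit `W = lim W_n`, meaningful at the points where the sequence converges. -/
def Wlim (ω : (ℕ → Θ) × Γ) : ℝ := limUnder atTop fun n => B.W n ω

end

end BPIRE

/-! Since `Z` never vanishes, `W (n + 1) = W n * (a + y)`, where `a` is the average of `X n i / m`
over the `Z n` individuals and `y = Y n / (m * Z n)`. It suffices that the increments `log (a + y)`
of `log W` have summable `L¹` norms: then `log W n` converges almost surely and in `L¹` to a finite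
`g`, and `W` is `exp g`.

By `Real.abs_log_add_le` an increment is at most a constant times `|a - 1| ^ ε + y ^ ε`, plus `log
m` on the event `|a - 1| > 1 / 2`; the last term is available because `X ≥ 1` forces `a ≥ 1 / m`.
For a fixed environment, generation `n` is independent of `Z n`, so `Z n` can be frozen at a value
`k`. A truncated weak law (`integral_abs_average_sub_one_le`) then bounds the first term by a factor
depending on `e n` times `k ^ (-η)`, with `η = (p - 1) * ε / 2`; the second has a bound of the same
form.

Everything reduces to the harmonic moments of `Z n`. Discarding immigrants and applying Jensen gives
a quenched bound by the product of the harmonic moments of the offspring laws at times before `n`.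
As the environment is i.i.d., the annealed bound is `ρ ^ n` with `ρ = E X ^ (-η) < 1`, strict
because `X ≥ 1` is not almost surely `1`. Hölder's inequality with exponent `r` separates `log m`
from the rare event and retains a geometric rate. -/

/-! ### Elementary inequalities for powers and logarithms. -/

/-- Jensen's inequality for the convex function `x ↦ x ^ (-η)`. -/
theorem Real.sum_rpow_neg_le {k : ℕ} (hk : k ≠ 0) {η : ℝ} (hη : 0 ≤ η) {x : ℕ → ℝ}
    (hx : ∀ i ∈ Finset.range k, 0 < x i) :
    (∑ i ∈ Finset.range k, x i) ^ (-η) ≤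
      (k : ℝ) ^ (-η) * ((k : ℝ)⁻¹ * ∑ i ∈ Finset.range k, x i ^ (-η)) := by
  have hk0 : (0 : ℝ) < k := by positivity
  have hw : ∑ _i ∈ Finset.range k, (k : ℝ)⁻¹ = 1 := by simp [hk]
  -- AM-GM is used twice, for `x` and for `x ^ (-η)`; the two bounds meet because the geometric mean
  -- commutes with powers.
  have h1 := Real.geom_mean_le_arith_mean_weighted (Finset.range k) (fun _ => (k : ℝ)⁻¹) x
    (fun _ _ => by positivity) hw (fun i hi => (hx i hi).le)
  have h2 := Real.geom_mean_le_arith_mean_weighted (Finset.range k) (fun _ => (k : ℝ)⁻¹)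
    (fun i => x i ^ (-η)) (fun _ _ => by positivity) hw
    (fun i hi => Real.rpow_nonneg (hx i hi).le _)
  rw [← Finset.mul_sum] at h1 h2
  have hpos : 0 < ∏ i ∈ Finset.range k, x i ^ (k : ℝ)⁻¹ :=
    Finset.prod_pos fun i hi => Real.rpow_pos_of_pos (hx i hi) _
  have hprod : ∏ i ∈ Finset.range k, (x i ^ (-η)) ^ (k : ℝ)⁻¹ =
      (∏ i ∈ Finset.range k, x i ^ (k : ℝ)⁻¹) ^ (-η) := by
    rw [← Real.finsetProd_rpow _ _ (fun i hi => Real.rpow_nonneg (hx i hi).le _)]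
    refine Finset.prod_congr rfl fun i hi => ?_
    rw [← Real.rpow_mul (hx i hi).le, ← Real.rpow_mul (hx i hi).le, mul_comm]
  have hS : ∑ i ∈ Finset.range k, x i =
      k * ((k : ℝ)⁻¹ * ∑ i ∈ Finset.range k, x i) := by field_simp
  have hS0 : 0 ≤ (k : ℝ)⁻¹ * ∑ i ∈ Finset.range k, x i := hpos.le.trans h1
  rw [hS, Real.mul_rpow hk0.le hS0]
  refine mul_le_mul_of_nonneg_left ?_ (by positivity)
  calc _ ≤ (∏ i ∈ Finset.range k, x i ^ (k : ℝ)⁻¹) ^ (-η) :=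
        Real.rpow_le_rpow_of_nonpos hpos h1 (by linarith)
    _ ≤ _ := hprod ▸ h2

/-- Subadditivity of `t ↦ t ^ ε` gives `(1 + x) ^ ε ≤ 1 + x ^ ε`, and `log (1 + t) ≤ t` finishes. -/
theorem Real.log_one_add_le_rpow_div {x ε : ℝ} (hx : 0 ≤ x) (hε : 0 < ε) (hε1 : ε ≤ 1) :
    Real.log (1 + x) ≤ x ^ ε / ε := by
  rw [le_div_iff₀ hε, mul_comm, ← Real.log_rpow (by positivity)]
  have h := Real.rpow_add_le_add_rpow zero_le_one hx hε.le hε1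
  rw [Real.one_rpow] at h
  have h0 : 0 ≤ x ^ ε := Real.rpow_nonneg hx _
  calc _ ≤ Real.log (1 + x ^ ε) := Real.log_le_log (by positivity) h
    _ ≤ (1 + x ^ ε) - 1 := Real.log_le_sub_one_of_pos (by positivity)
    _ = _ := by ring

/-- The logarithm of `a + y` with `a` close to `1` and `y ≥ 0` small. -/
theorem Real.abs_log_add_le {a y m ε : ℝ} (hm : 1 ≤ m) (ha : m⁻¹ ≤ a) (hy : 0 ≤ y)
    (hε : 0 < ε) (hε1 : ε ≤ 1) :
    |Real.log (a + y)| ≤ 2 / ε * (|a - 1| ^ ε + y ^ ε) +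
      if 1 / 2 < |a - 1| then Real.log m else 0 := by
  have hm0 : 0 < m := by linarith
  have ha0 : 0 < a := lt_of_lt_of_le (by positivity) ha
  have hA : 0 ≤ |a - 1| ^ ε := by positivity
  have hY : 0 ≤ y ^ ε := by positivity
  have hlm : 0 ≤ Real.log m := Real.log_nonneg hm
  have hite : 0 ≤ if 1 / 2 < |a - 1| then Real.log m else 0 := by split_ifs <;> simp [hlm]
  rcases le_total 1 (a + y) with h | h
  -- Upper side: `a + y ≤ (1 + |a - 1|) * (1 + y)`.
  · rw [abs_of_nonneg (Real.log_nonneg h)]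
    have h1 := Real.log_one_add_le_rpow_div (abs_nonneg (a - 1)) hε hε1
    have h2 := Real.log_one_add_le_rpow_div hy hε hε1
    have h3 : Real.log (a + y) ≤ Real.log (1 + |a - 1|) + Real.log (1 + y) := by
      rw [← Real.log_mul (by positivity) (by positivity)]
      refine Real.log_le_log (by positivity) ?_
      nlinarith [le_abs_self (a - 1), mul_nonneg (abs_nonneg (a - 1)) hy]
    have h4 : |a - 1| ^ ε / ε + y ^ ε / ε ≤ 2 / ε * (|a - 1| ^ ε + y ^ ε) := by
      rw [← add_div, div_mul_eq_mul_div]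
      gcongr
      linarith
    linarith
  -- Lower side: `y` only helps, so only `-log a` matters. It is at most `log m` always, and at most
  -- `2 * |a - 1|` when `a ≥ 1 / 2`.
  · rw [abs_of_nonpos (Real.log_nonpos (by positivity) h)]
    have h1 : -Real.log (a + y) ≤ -Real.log a :=
      neg_le_neg (Real.log_le_log ha0 (by linarith))
    split_ifs with hh
    · have : -Real.log a ≤ Real.log m := by
        rw [← Real.log_inv]
        exact Real.log_le_log (by positivity) (by rw [inv_le_comm₀ ha0 hm0]; exact ha)
      have : 0 ≤ 2 / ε * (|a - 1| ^ ε + y ^ ε) := by positivity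
      linarith
    · push Not at hh
      have ha2 : 1 / 2 ≤ a := by linarith [neg_abs_le (a - 1)]
      have h2 : -Real.log a ≤ 2 * |a - 1| := by
        have h3 := Real.one_sub_inv_le_log_of_pos ha0
        have h4 : a⁻¹ - 1 = (1 - a) * a⁻¹ := by field_simp
        have h5 : (1 - a) * a⁻¹ ≤ |a - 1| * 2 := by
          refine mul_le_mul ?_ ?_ (by positivity) (abs_nonneg _)
          · rw [abs_sub_comm]; exact le_abs_self _
          · rw [inv_le_comm₀ ha0 (by norm_num)]; linarith
        linarith
      have h6 : |a - 1| ≤ |a - 1| ^ ε := by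
        simpa using Real.rpow_le_rpow_of_exponent_ge' (abs_nonneg (a - 1)) (by linarith) hε.le hε1
      have h7 : 2 * (|a - 1| ^ ε + y ^ ε) ≤ 2 / ε * (|a - 1| ^ ε + y ^ ε) := by
        gcongr
        rw [le_div_iff₀ hε]; linarith
      linarith

/-! ### Convergence from summable increments, freezing, and i.i.d. products. -/

/-- A sequence of functions whose increments are summable in `L¹` converges almost everywhere and
in `L¹`. -/
theorem MeasureTheory.exists_tendsto_of_tsum_lintegral_ne_top {Ω : Type*} [MeasurableSpace Ω]
    {μ : Measure Ω} {f : ℕ → Ω → ℝ} (hf : ∀ n, Measurable (f n)) (h0 : Integrable (f 0) μ)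
    (hsum : ∑' n, ∫⁻ ω, ‖f (n + 1) ω - f n ω‖ₑ ∂μ ≠ ∞) :
    ∃ g : Ω → ℝ, (∀ᵐ ω ∂μ, Tendsto (fun n => f n ω) atTop (𝓝 (g ω))) ∧
      (∀ n, Integrable (f n) μ) ∧ Integrable g μ ∧
      Tendsto (fun n => eLpNorm (fun ω => f n ω - g ω) 1 μ) atTop (𝓝 0) := by
  have hmeas : ∀ n, Measurable fun ω => ‖f (n + 1) ω - f n ω‖ₑ := fun n =>
    ((hf (n + 1)).sub (hf n)).enorm
  have hae : ∀ᵐ ω ∂μ, ∑' n, ‖f (n + 1) ω - f n ω‖ₑ < ∞ := by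
    refine ae_lt_top (Measurable.tsum hmeas) ?_
    rwa [lintegral_tsum fun n => (hmeas n).aemeasurable]
  have hconv : ∀ᵐ ω ∂μ, ∃ l, Tendsto (fun n => f n ω) atTop (𝓝 l) := by
    filter_upwards [hae] with ω hω
    refine cauchySeq_tendsto_of_complete
      (cauchySeq_of_edist_le_of_tsum_ne_top (fun n => ‖f (n + 1) ω - f n ω‖ₑ) (fun n => ?_) hω.ne)
    rw [edist_comm, edist_eq_enorm_sub]
  obtain ⟨g, hg, hlim⟩ := measurable_limit_of_tendsto_metrizable_ae
    (fun n => (hf n).aemeasurable) hconv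
  have hint : ∀ n, Integrable (f n) μ := by
    intro n
    induction n with
    | zero => exact h0
    | succ n ih =>
      have : Integrable (fun ω => f (n + 1) ω - f n ω) μ :=
        ⟨((hf _).sub (hf _)).aestronglyMeasurable,
          lt_of_le_of_lt (ENNReal.le_tsum n) (lt_top_iff_ne_top.2 hsum)⟩
      refine (this.add ih).congr (ae_of_all _ fun ω => ?_)
      simp
  have hbound : ∀ n, ∫⁻ ω, ‖f n ω - g ω‖ₑ ∂μ ≤
      ∑' k, ∫⁻ ω, ‖f (k + n + 1) ω - f (k + n) ω‖ₑ ∂μ := by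
    intro n
    rw [← lintegral_tsum fun k => (hmeas (k + n)).aemeasurable]
    refine lintegral_mono_ae ?_
    filter_upwards [hlim] with ω hω
    have := edist_le_tsum_of_edist_le_of_tendsto (fun n => ‖f (n + 1) ω - f n ω‖ₑ)
      (fun n => by rw [edist_comm, edist_eq_enorm_sub]) hω n
    simpa [edist_eq_enorm_sub, add_comm, add_left_comm] using this
  have hL1 : Tendsto (fun n => eLpNorm (fun ω => f n ω - g ω) 1 μ) atTop (𝓝 0) := by
    simp_rw [eLpNorm_one_eq_lintegral_enorm]
    exact tendsto_of_tendsto_of_tendsto_of_le_of_le tendsto_const_nhds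
      (ENNReal.tendsto_sum_nat_add _ hsum) (fun _ => zero_le) hbound
  refine ⟨g, hlim, hint, ?_, hL1⟩
  have hd : Integrable (fun ω => f 0 ω - g ω) μ :=
    ⟨(hf 0).aestronglyMeasurable.sub hg.aestronglyMeasurable,
      lt_of_le_of_lt (hbound 0) (lt_top_iff_ne_top.2 (by simpa using hsum))⟩
  refine (h0.sub hd).congr (ae_of_all _ fun ω => ?_)
  simp

/-- Freezing: integrate a random function evaluated at an independent integer. -/
theorem ProbabilityTheory.Indep.lintegral_freeze_le {Ω : Type*}
    {m₁ m₂ mΩ : MeasurableSpace Ω} {μ : Measure Ω} (h₁ : m₁ ≤ mΩ) (h₂ : m₂ ≤ mΩ)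
    (hind : Indep m₁ m₂ μ) {N : Ω → ℕ} (hN : Measurable[m₁] N) (hN0 : ∀ᵐ ω ∂μ, N ω ≠ 0)
    {G : ℕ → Ω → ℝ≥0∞} (hG : ∀ k, Measurable[m₂] (G k)) {c : ℝ≥0∞} {g : ℕ → ℝ≥0∞}
    (hle : ∀ k, k ≠ 0 → ∫⁻ ω, G k ω ∂μ ≤ c * g k) :
    ∫⁻ ω, G (N ω) ω ∂μ ≤ c * ∫⁻ ω, g (N ω) ∂μ := by
  have hset : ∀ k, MeasurableSet[m₁] (N ⁻¹' {k}) := fun k => hN (measurableSet_singleton k)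
  have hind1 : ∀ k, Measurable[m₁] ((N ⁻¹' {k}).indicator fun _ => (1 : ℝ≥0∞)) := fun k =>
    Measurable.indicator (@measurable_const _ _ _ m₁ _) (hset k)
  -- The term `k = 0` is removed because nothing bounds `G 0`; this is harmless since `N ≠ 0` almost
  -- everywhere.
  have hsplit : ∀ F : ℕ → Ω → ℝ≥0∞, ∀ᵐ ω ∂μ, F (N ω) ω =
      ∑' k : ℕ, if k = 0 then 0 else (N ⁻¹' {k}).indicator (fun _ => (1 : ℝ≥0∞)) ω * F k ω := by
    intro F
    filter_upwards [hN0] with ω hω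
    rw [tsum_eq_single (N ω)]
    · simp [hω]
    · intro k hk
      simp [Set.indicator, Ne.symm hk]
  have hm : ∀ F : ℕ → Ω → ℝ≥0∞, (∀ k, Measurable (F k)) → ∀ k : ℕ, AEMeasurable (fun ω =>
      if k = 0 then 0 else (N ⁻¹' {k}).indicator (fun _ => (1 : ℝ≥0∞)) ω * F k ω) μ := by
    intro F hF k
    by_cases hk : k = 0
    · simp [hk]
    · simp only [hk, if_false]
      exact (((hind1 k).mono h₁ le_rfl).mul (hF k)).aemeasurable
  rw [lintegral_congr_ae (hsplit G), lintegral_congr_ae (hsplit fun k _ => g k),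
    lintegral_tsum (hm G fun k => (hG k).mono h₂ le_rfl),
    lintegral_tsum (hm _ fun k => measurable_const), ← ENNReal.tsum_mul_left]
  refine ENNReal.tsum_le_tsum fun k => ?_
  by_cases hk : k = 0
  · simp [hk]
  simp only [hk, if_false]
  rw [lintegral_mul_eq_lintegral_mul_lintegral_of_independent_measurableSpace h₁ h₂ hind
    (hind1 k) (hG k), lintegral_mul_const _ ((hind1 k).mono h₁ le_rfl)]
  calc _ ≤ _ := mul_le_mul_right (hle k hk) _
    _ = _ := by ring

/-- The integral of a product of functions of the first `n + 1` coordinates of an i.i.d. sequence. -/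
theorem MeasureTheory.lintegral_prod_mul_infinitePi {Θ : Type*} [MeasurableSpace Θ]
    (ν : Measure Θ) [IsProbabilityMeasure ν] {a b : Θ → ℝ≥0∞} (ha : Measurable a)
    (hb : Measurable b) (n : ℕ) :
    ∫⁻ e, (∏ j ∈ Finset.range n, a (e j)) * b (e n) ∂(Measure.infinitePi fun _ : ℕ => ν) =
      (∫⁻ θ, a θ ∂ν) ^ n * ∫⁻ θ, b θ ∂ν := by
  set F : ℕ → Θ → ℝ≥0∞ := fun j => if j = n then b else a with hF
  have hFm : ∀ j, Measurable (F j) := fun j => by simp only [hF]; split_ifs <;> assumption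
  have hind : iIndepFun (fun j (e : ℕ → Θ) => F j (e j)) (Measure.infinitePi fun _ : ℕ => ν) :=
    iIndepFun_infinitePi (P := fun _ => ν) (X := F) hFm
  have hval : ∀ j, ∫⁻ e, F j (e j) ∂(Measure.infinitePi fun _ : ℕ => ν) = ∫⁻ θ, F j θ ∂ν := by
    intro j
    exact (measurePreserving_eval_infinitePi (fun _ : ℕ => ν) j).lintegral_comp (hFm j)
  have hne : ∀ j ∈ Finset.range n, F j = a := fun j hj => by
    simp [hF, (Finset.mem_range.1 hj).ne]
  have h := lintegral_prod_eq_prod_lintegral_of_indepFun (Finset.range (n + 1)) _ hind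
    (fun j => (hFm j).comp (measurable_pi_apply j))
  simp only [hval, Finset.prod_range_succ] at h
  rw [Finset.prod_congr rfl fun j hj => by rw [hne j hj]] at h
  have h' : ∀ e : ℕ → Θ, ∏ j ∈ Finset.range n, F j (e j) = ∏ j ∈ Finset.range n, a (e j) :=
    fun e => Finset.prod_congr rfl fun j hj => by rw [hne j hj]
  simp only [h'] at h
  simpa [hF] using h

/-! ### The weak law of large numbers with a rate. -/

theorem MeasureTheory.integral_abs_le_sqrt_integral_sq {Ω : Type*} [MeasurableSpace Ω]
    {μ : Measure Ω} [IsProbabilityMeasure μ] {f : Ω → ℝ} (hf : MemLp f 2 μ) :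
    ∫ ω, |f ω| ∂μ ≤ √(∫ ω, f ω ^ 2 ∂μ) := by
  refine Real.le_sqrt_of_sq_le ?_
  have h := variance_nonneg (fun ω => |f ω|) μ
  rw [variance_eq_sub (X := fun ω => |f ω|) hf.abs] at h
  simpa using h

/-- A quantitative weak law of large numbers in `L¹`, for nonnegative variables of mean `1` with
a finite moment of order `p ∈ (1, 2]`. -/
theorem ProbabilityTheory.integral_abs_average_sub_one_le {Ω : Type*} [MeasurableSpace Ω]
    {μ : Measure Ω} [IsProbabilityMeasure μ] {V : ℕ → Ω → ℝ} (hmeas : ∀ i, Measurable (V i))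
    (hpos : ∀ i ω, 0 ≤ V i ω) (hind : Pairwise fun i j => V i ⟂ᵢ[μ] V j)
    (hid : ∀ i, IdentDistrib (V i) (V 0) μ μ) (hint : Integrable (V 0) μ)
    (hone : ∫ ω, V 0 ω ∂μ = 1) {p : ℝ} (hp1 : 1 < p) (hp2 : p ≤ 2)
    (hp : Integrable (fun ω => V 0 ω ^ p) μ) {k : ℕ} (hk : k ≠ 0) :
    ∫ ω, |(k : ℝ)⁻¹ * ∑ i ∈ Finset.range k, V i ω - 1| ∂μ ≤
      2 * ((k : ℝ) ^ (1 - p) * ∫ ω, V 0 ω ^ p ∂μ) +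
        √((k : ℝ) ^ (1 - p) * ∫ ω, V 0 ω ^ p ∂μ) := by
  have hk0 : (0 : ℝ) < k := by positivity
  set M := ∫ ω, V 0 ω ^ p ∂μ with hM
  -- Truncation at level `k`, the number of summands. Both the tail and the second moment of the
  -- truncated variable are then controlled by `v ^ p` times a power of `k`.
  set φ : ℝ → ℝ := (Set.Iic (k : ℝ)).indicator id with hφ
  have hφm : Measurable φ := measurable_id.indicator measurableSet_Iic
  have hφ0 : ∀ v, 0 ≤ v → 0 ≤ φ v := fun v hv => by
    simp only [hφ, Set.indicator]; split_ifs <;> simp [hv]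
  have hφle : ∀ v, 0 ≤ v → φ v ≤ v := fun v hv => by
    simp only [hφ, Set.indicator]; split_ifs <;> simp [hv]
  have hφk : ∀ v, φ v ≤ k := fun v => by
    simp only [hφ, Set.indicator]
    split_ifs with h
    · exact h
    · exact hk0.le
  have hφR : ∀ v, 0 ≤ v → v - φ v ≤ (k : ℝ) ^ (1 - p) * v ^ p := fun v hv => by
    simp only [hφ, Set.indicator]
    split_ifs with h
    · simp; positivity
    · simp only [Set.mem_Iic, not_le] at h
      have hv0 : 0 < v := hk0.trans h
      calc v - 0 = v ^ (1 - p) * v ^ p := by rw [← Real.rpow_add hv0]; simp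
        _ ≤ _ := mul_le_mul_of_nonneg_right
          (Real.rpow_le_rpow_of_nonpos hk0 h.le (by linarith)) (by positivity)
  have hφsq : ∀ v, 0 ≤ v → φ v ^ 2 ≤ (k : ℝ) ^ (2 - p) * v ^ p := fun v hv => by
    simp only [hφ, Set.indicator]
    split_ifs with h
    · rcases hv.eq_or_lt with rfl | hv0
      · simp; positivity
      calc (id v) ^ 2 = v ^ (2 - p) * v ^ p := by
            rw [← Real.rpow_add hv0, ← Real.rpow_natCast]; simp
        _ ≤ _ := mul_le_mul_of_nonneg_right
          (Real.rpow_le_rpow hv h (by linarith)) (by positivity)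
    · simp; positivity
  set T : ℕ → Ω → ℝ := fun i ω => φ (V i ω) with hT
  have hTm : ∀ i, Measurable (T i) := fun i => hφm.comp (hmeas i)
  have hTid : ∀ i, IdentDistrib (T i) (T 0) μ μ := fun i => (hid i).comp hφm
  have hTbd : ∀ i ω, ‖T i ω‖ ≤ k := fun i ω => by
    rw [Real.norm_of_nonneg (hφ0 _ (hpos i ω))]; exact hφk _
  have hT2 : ∀ i, MemLp (T i) 2 μ := fun i =>
    MemLp.of_bound (hTm i).aestronglyMeasurable k (ae_of_all _ (hTbd i))
  have hTi : ∀ i, Integrable (T i) μ := fun i => (hT2 i).integrable (by norm_num)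
  have hVi : ∀ i, Integrable (V i) μ := fun i => (hid i).integrable_iff.2 hint
  set t := ∫ ω, T 0 ω ∂μ with ht
  have hTt : ∀ i, ∫ ω, T i ω ∂μ = t := fun i => (hTid i).integral_eq
  have hRint : ∀ i, ∫ ω, (V i ω - T i ω) ∂μ = 1 - t := fun i => by
    rw [integral_sub (hVi i) (hTi i), hTt i, (hid i).integral_eq, hone]
  have ht1 : 1 - t ≤ (k : ℝ) ^ (1 - p) * M := by
    rw [← hRint 0, hM, ← integral_const_mul]
    exact integral_mono ((hVi 0).sub (hTi 0)) (hp.const_mul _) fun ω => hφR _ (hpos 0 ω)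
  have ht0 : 0 ≤ 1 - t := by
    rw [← hRint 0]
    exact integral_nonneg fun ω => sub_nonneg.2 (hφle _ (hpos 0 ω))
  set S : Ω → ℝ := ∑ i ∈ Finset.range k, T i with hS
  have hS2 : MemLp S 2 μ := memLp_finsetSum' _ fun i _ => hT2 i
  have hSint : ∫ ω, S ω ∂μ = k * t := by
    simp only [hS, Finset.sum_apply]
    rw [integral_finsetSum _ fun i _ => hTi i]
    simp [hTt]
  have hvar : ∫ ω, (S ω - k * t) ^ 2 ∂μ ≤ k * ((k : ℝ) ^ (2 - p) * M) := by
    have h1 : variance S μ = ∫ ω, (S ω - k * t) ^ 2 ∂μ := by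
      rw [variance_eq_integral hS2.aestronglyMeasurable.aemeasurable, hSint]
    rw [← h1, hS, IndepFun.variance_sum (fun i _ => hT2 i)
      (fun i _ j _ hij => (hind hij).comp hφm hφm)]
    have h2 : ∀ i ∈ Finset.range k, variance (T i) μ ≤ (k : ℝ) ^ (2 - p) * M := fun i _ => by
      rw [(hTid i).variance_eq]
      refine (variance_le_expectation_sq (hTm 0).aestronglyMeasurable).trans ?_
      rw [hM, ← integral_const_mul]
      exact integral_mono (hT2 0).integrable_sq (hp.const_mul _) fun ω => hφsq _ (hpos 0 ω)
    simpa using Finset.sum_le_sum h2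
  have hSt2 : MemLp (fun ω => S ω - k * t) 2 μ := hS2.sub (memLp_const _)
  have hStabs : ∫ ω, |S ω - k * t| ∂μ ≤ √(k * ((k : ℝ) ^ (2 - p) * M)) :=
    (integral_abs_le_sqrt_integral_sq hSt2).trans (Real.sqrt_le_sqrt hvar)
  have hpt : ∀ ω, |(k : ℝ)⁻¹ * ∑ i ∈ Finset.range k, V i ω - 1| ≤
      ((k : ℝ)⁻¹ * |S ω - k * t| + (k : ℝ)⁻¹ * ∑ i ∈ Finset.range k, (V i ω - T i ω)) +
        (1 - t) := by
    intro ω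
    have hR0 : 0 ≤ (k : ℝ)⁻¹ * ∑ i ∈ Finset.range k, (V i ω - T i ω) :=
      mul_nonneg (by positivity)
        (Finset.sum_nonneg fun i _ => sub_nonneg.2 (hφle _ (hpos i ω)))
    -- Centred truncated sum, plus average tail, minus the mean of the tail. The last two each
    -- contribute `1 - t` in `L¹`, whence the factor `2` in the bound; the first is controlled by
    -- its variance.
    have hdec : (k : ℝ)⁻¹ * ∑ i ∈ Finset.range k, V i ω - 1 =
        (k : ℝ)⁻¹ * (S ω - k * t) + (k : ℝ)⁻¹ * ∑ i ∈ Finset.range k, (V i ω - T i ω) -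
          (1 - t) := by
      simp only [hS, Finset.sum_apply, Finset.sum_sub_distrib]
      field_simp
      ring
    have h1 : |(k : ℝ)⁻¹ * (S ω - k * t)| = (k : ℝ)⁻¹ * |S ω - k * t| := by
      rw [abs_mul, abs_of_pos (by positivity)]
    rw [hdec, ← h1]
    refine (abs_sub _ _).trans ?_
    rw [abs_of_nonneg ht0]
    refine add_le_add_left ((abs_add_le _ _).trans ?_) _
    rw [abs_of_nonneg hR0]
  have hi1 : Integrable (fun ω => (k : ℝ)⁻¹ * |S ω - k * t|) μ :=
    ((hSt2.integrable (by norm_num)).abs).const_mul _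
  have hi2 : Integrable (fun ω => (k : ℝ)⁻¹ * ∑ i ∈ Finset.range k, (V i ω - T i ω)) μ :=
    (integrable_finsetSum _ fun i _ => (hVi i).sub (hTi i)).const_mul _
  have hiL : Integrable (fun ω => |(k : ℝ)⁻¹ * ∑ i ∈ Finset.range k, V i ω - 1|) μ :=
    (((integrable_finsetSum _ fun i _ => hVi i).const_mul _).sub (integrable_const _)).abs
  have hRi : ∀ i, Integrable (fun ω => V i ω - T i ω) μ := fun i => (hVi i).sub (hTi i)
  have hi12 : Integrable (fun ω => (k : ℝ)⁻¹ * |S ω - k * t| +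
      (k : ℝ)⁻¹ * ∑ i ∈ Finset.range k, (V i ω - T i ω)) μ := hi1.add hi2
  refine (integral_mono hiL (hi12.add (integrable_const _)) hpt).trans ?_
  rw [integral_add' hi12 (integrable_const _), integral_add hi1 hi2, integral_const_mul, integral_const_mul,
    integral_finsetSum _ fun i _ => hRi i]
  simp only [hRint, Finset.sum_const, Finset.card_range, nsmul_eq_mul, integral_const,
    probReal_univ, one_smul]
  have hsq : (k : ℝ)⁻¹ * √(k * ((k : ℝ) ^ (2 - p) * M)) = √((k : ℝ) ^ (1 - p) * M) := by
    have h1 : (k : ℝ) * ((k : ℝ) ^ (2 - p) * M) = (k : ℝ) ^ 2 * ((k : ℝ) ^ (1 - p) * M) := by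
      have : (k : ℝ) ^ (2 - p) = k * (k : ℝ) ^ (1 - p) := by
        rw [show 2 - p = 1 + (1 - p) by ring, Real.rpow_add hk0, Real.rpow_one]
      rw [this]; ring
    rw [h1, Real.sqrt_mul (by positivity), Real.sqrt_sq hk0.le, inv_mul_cancel_left₀ hk0.ne']
  have h3 : (k : ℝ)⁻¹ * (k * (1 - t)) = 1 - t := inv_mul_cancel_left₀ hk0.ne' _
  have h4 : (k : ℝ)⁻¹ * ∫ ω, |S ω - k * t| ∂μ ≤ √((k : ℝ) ^ (1 - p) * M) := by
    rw [← hsq]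
    exact mul_le_mul_of_nonneg_left hStabs (by positivity)
  linarith

/-! ### Generations and regular environments. -/

theorem Measurable.add_sum_range_nat {Ω : Type*} [MeasurableSpace Ω] {a N : Ω → ℕ}
    (ha : Measurable a) (hN : Measurable N) {f : ℕ → Ω → ℕ} (hf : ∀ i, Measurable (f i)) :
    Measurable fun ω => a ω + ∑ i ∈ Finset.range (N ω), f i ω := by
  have h : Measurable fun q : ℕ × Ω => ∑ i ∈ Finset.range q.1, f i q.2 :=
    measurable_from_prod_countable_right fun k =>
      Finset.measurable_fun_sum (Finset.range k) fun i _ => hf i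
  exact ha.add (h.comp (hN.prodMk measurable_id))

namespace BPIRE

variable {Θ Γ : Type*} [MeasurableSpace Θ] [MeasurableSpace Γ] (B : BPIRE Θ Γ)

/-- The σ-algebra generated by the reproduction and the immigration in the generations in `S`. -/
@[reducible]
def generations (S : Set ℕ) : MeasurableSpace Γ :=
  ⨆ i ∈ (Sum.elim Prod.fst id ⁻¹' S : Set ((ℕ × ℕ) ⊕ ℕ)),
    MeasurableSpace.comap (Sum.elim (fun a : ℕ × ℕ => B.X a.1 a.2) B.Y i) ⊤

theorem measurable_sumElim (i : (ℕ × ℕ) ⊕ ℕ) :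
    Measurable (Sum.elim (fun a : ℕ × ℕ => B.X a.1 a.2) B.Y i) := by
  rcases i with a | j
  · exact B.measurable_X a.1 a.2
  · exact B.measurable_Y j

theorem generations_le (S : Set ℕ) : B.generations S ≤ ‹MeasurableSpace Γ› :=
  iSup₂_le fun i _ => (B.measurable_sumElim i).comap_le

theorem measurable_X_generations {S : Set ℕ} {n : ℕ} (hn : n ∈ S) (i : ℕ) :
    Measurable[B.generations S] (B.X n i) := by
  have : MeasurableSpace.comap (B.X n i) ⊤ ≤ B.generations S :=
    le_iSup₂_of_le (Sum.inl (n, i)) hn le_rfl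
  exact Measurable.mono (comap_measurable _) this le_rfl

theorem measurable_Y_generations {S : Set ℕ} {n : ℕ} (hn : n ∈ S) :
    Measurable[B.generations S] (B.Y n) := by
  have : MeasurableSpace.comap (B.Y n) ⊤ ≤ B.generations S :=
    le_iSup₂_of_le (Sum.inr n) hn le_rfl
  exact Measurable.mono (comap_measurable _) this le_rfl

theorem measurable_Z_generations {S : Set ℕ} (n : ℕ) (hn : ∀ j < n, j ∈ S) :
    Measurable[B.generations S] (B.Z n) := by
  induction n with
  | zero => exact @measurable_const _ _ _ (B.generations S) _
  | succ n ih =>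
    exact @Measurable.add_sum_range_nat _ (B.generations S) _ _
      (B.measurable_Y_generations (hn n n.lt_succ_self))
      (ih fun j hj => hn j (hj.trans n.lt_succ_self)) _
      fun i => B.measurable_X_generations (hn n n.lt_succ_self) i

theorem measurable_Z (n : ℕ) : Measurable (B.Z n) :=
  (B.measurable_Z_generations (S := Set.univ) n fun _ _ => Set.mem_univ _).mono
    (B.generations_le _) le_rfl

theorem measurable_mean : Measurable B.mean :=
  Measurable.tsum fun k =>
    (B.offspring.measurable_coe (measurableSet_singleton k)).const_mul (k : ℝ≥0∞)

theorem mean_eq_lintegral (θ : Θ) : B.mean θ = ∫⁻ k : ℕ, (k : ℝ≥0∞) ∂B.offspring θ := by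
  rw [lintegral_countable']; rfl

/-- The environments with the almost sure properties that the proof uses. -/
structure IsRegular (e : ℕ → Θ) : Prop where
  map_X : ∀ n i, (B.quenched e).map (B.X n i) = B.offspring (e n)
  map_Y : ∀ n, (B.quenched e).map (B.Y n) = B.immigration (e n)
  indep : iIndepFun (Sum.elim (fun a : ℕ × ℕ => B.X a.1 a.2) B.Y) (B.quenched e)
  offspring_zero : ∀ n, B.offspring (e n) {0} = 0
  mean_ne_top : ∀ n, B.mean (e n) ≠ ∞

variable {B} {e : ℕ → Θ}

theorem one_le_mean {θ : Θ} (h : B.offspring θ {0} = 0) : 1 ≤ B.mean θ := by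
  rw [mean_eq_lintegral]
  have hae : ∀ᵐ k : ℕ ∂B.offspring θ, (1 : ℝ≥0∞) ≤ (k : ℝ≥0∞) := by
    have : ∀ᵐ k ∂B.offspring θ, k ∉ ({0} : Set ℕ) := measure_eq_zero_iff_ae_notMem.1 h
    filter_upwards [this] with k hk
    exact_mod_cast Nat.one_le_iff_ne_zero.2 hk
  simpa using lintegral_mono_ae hae

namespace IsRegular

variable (h : B.IsRegular e)
include h

theorem lintegral_X (n i : ℕ) (f : ℕ → ℝ≥0∞) :
    ∫⁻ x, f (B.X n i x) ∂B.quenched e = ∫⁻ k, f k ∂B.offspring (e n) := by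
  rw [← h.map_X n i, lintegral_map (measurable_of_countable f) (B.measurable_X n i)]

theorem lintegral_Y (n : ℕ) (f : ℕ → ℝ≥0∞) :
    ∫⁻ x, f (B.Y n x) ∂B.quenched e = ∫⁻ k, f k ∂B.immigration (e n) := by
  rw [← h.map_Y n, lintegral_map (measurable_of_countable f) (B.measurable_Y n)]

theorem indep_generations (n : ℕ) :
    Indep (B.generations (Set.Iio n)) (B.generations {n}) (B.quenched e) := by
  refine indep_iSup_of_disjoint (fun i => (B.measurable_sumElim i).comap_le)
    ((iIndepFun_iff_iIndep _ _ _).1 h.indep) ?_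
  exact Disjoint.preimage _ (by simp)

theorem ae_X_ne_zero : ∀ᵐ x ∂B.quenched e, ∀ n i, B.X n i x ≠ 0 := by
  rw [ae_all_iff]; intro n
  rw [ae_all_iff]; intro i
  have h0 : (B.quenched e).map (B.X n i) {0} = 0 := by rw [h.map_X, h.offspring_zero]
  rw [Measure.map_apply (B.measurable_X n i) (measurableSet_singleton 0)] at h0
  exact measure_eq_zero_iff_ae_notMem.1 h0

omit h in
theorem _root_.BPIRE.Z_ne_zero {x : Γ} (hx : ∀ n i, B.X n i x ≠ 0) (n : ℕ) : B.Z n x ≠ 0 := by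
  induction n with
  | zero => simp [Z]
  | succ n ih =>
    have h1 : 0 < ∑ i ∈ Finset.range (B.Z n x), B.X n i x :=
      Finset.sum_pos (fun i _ => Nat.pos_of_ne_zero (hx n i)) (by simpa using ih)
    simp only [Z]
    omega

theorem ae_Z_ne_zero (n : ℕ) : ∀ᵐ x ∂B.quenched e, B.Z n x ≠ 0 := by
  filter_upwards [h.ae_X_ne_zero] with x hx using Z_ne_zero hx n

/-- The quenched form of conditioning on `Z n`: it depends on generations before `n` only, so a
bound for each fixed population size `k` integrates to a bound at `Z n`. -/
theorem lintegral_Z_le (n : ℕ) {G : ℕ → Γ → ℝ≥0∞}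
    (hG : ∀ k, Measurable[B.generations {n}] (G k)) {c : ℝ≥0∞} {g : ℕ → ℝ≥0∞}
    (hle : ∀ k, k ≠ 0 → ∫⁻ x, G k x ∂B.quenched e ≤ c * g k) :
    ∫⁻ x, G (B.Z n x) x ∂B.quenched e ≤ c * ∫⁻ x, g (B.Z n x) ∂B.quenched e :=
  (h.indep_generations n).lintegral_freeze_le (B.generations_le _) (B.generations_le _)
    (B.measurable_Z_generations n fun _ hj => hj) (h.ae_Z_ne_zero n) hG hle

end IsRegular

end BPIRE

/-! ### Quenched moment bounds. -/

theorem ENNReal.natCast_rpow_eq_ofReal {n : ℕ} (hn : n ≠ 0) (s : ℝ) :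
    (n : ℝ≥0∞) ^ s = ENNReal.ofReal ((n : ℝ) ^ s) := by
  rw [← ENNReal.ofReal_rpow_of_pos (by positivity), ENNReal.ofReal_natCast]

theorem MeasureTheory.lintegral_rpow_le_rpow_lintegral {Ω : Type*} [MeasurableSpace Ω]
    {μ : Measure Ω} [IsProbabilityMeasure μ] {f : Ω → ℝ≥0∞} (hf : AEMeasurable f μ) {ε : ℝ}
    (hε : 0 < ε) (hε1 : ε ≤ 1) : ∫⁻ ω, f ω ^ ε ∂μ ≤ (∫⁻ ω, f ω ∂μ) ^ ε := by
  have h := eLpNorm'_le_eLpNorm'_of_exponent_le hε hε1 μ hf.aestronglyMeasurable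
  simp only [eLpNorm', enorm_eq_self, ENNReal.rpow_one, div_one] at h
  rwa [one_div, ENNReal.rpow_inv_le_iff hε] at h

theorem Measurable.sum_range_comp_nat {Ω M : Type*} [MeasurableSpace Ω] [MeasurableSpace M]
    [AddCommMonoid M] [MeasurableAdd₂ M] {f : ℕ → Ω → ℕ} (hf : ∀ i, Measurable (f i)) (φ : ℕ → M)
    (k : ℕ) : Measurable fun ω => ∑ i ∈ Finset.range k, φ (f i ω) :=
  Finset.measurable_fun_sum _ fun i _ => (measurable_of_countable φ).comp (hf i)

namespace BPIRE

variable {Θ Γ : Type*} [MeasurableSpace Θ] [MeasurableSpace Γ] (B : BPIRE Θ Γ)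

/-- The normalized moment `E (X / m) ^ p` of the offspring distribution. -/
noncomputable def offspringMoment (p : ℝ) (θ : Θ) : ℝ≥0∞ :=
  ∫⁻ k : ℕ, ((k : ℝ≥0∞) / B.mean θ) ^ p ∂B.offspring θ

/-- The harmonic moment `E X ^ (-η)` of the offspring distribution. -/
noncomputable def harmonicMoment (η : ℝ) (θ : Θ) : ℝ≥0∞ :=
  ∫⁻ k : ℕ, (k : ℝ≥0∞) ^ (-η) ∂B.offspring θ

/-- The normalized moment `E (Y / m) ^ ε` of the immigration distribution. -/
noncomputable def immigrationMoment (ε : ℝ) (θ : Θ) : ℝ≥0∞ :=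
  ∫⁻ k : ℕ, ((k : ℝ≥0∞) / B.mean θ) ^ ε ∂B.immigration θ

/-- The average of the normalized offspring numbers of the first `k` individuals. -/
noncomputable def average (n k : ℕ) (e : ℕ → Θ) (x : Γ) : ℝ :=
  (k : ℝ)⁻¹ * ∑ i ∈ Finset.range k, (B.X n i x : ℝ) / (B.mean (e n)).toReal

variable {B} {e : ℕ → Θ}

namespace IsRegular

variable (h : B.IsRegular e)
include h

theorem one_le_toReal_mean (n : ℕ) : 1 ≤ (B.mean (e n)).toReal := by
  rw [← ENNReal.toReal_one]
  exact ENNReal.toReal_mono (h.mean_ne_top n) (one_le_mean (h.offspring_zero n))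

theorem lintegral_Z_rpow_neg_succ_le {η : ℝ} (hη : 0 ≤ η) (n : ℕ) :
    ∫⁻ x, (B.Z (n + 1) x : ℝ≥0∞) ^ (-η) ∂B.quenched e ≤
      B.harmonicMoment η (e n) * ∫⁻ x, (B.Z n x : ℝ≥0∞) ^ (-η) ∂B.quenched e := by
  set G : ℕ → Γ → ℝ≥0∞ := fun k x =>
    (k : ℝ≥0∞) ^ (-η) * ((k : ℝ≥0∞)⁻¹ * ∑ i ∈ Finset.range k, (B.X n i x : ℝ≥0∞) ^ (-η)) with hG
  have hXm : ∀ i, Measurable fun x => (B.X n i x : ℝ≥0∞) ^ (-η) := fun i =>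
    (measurable_of_countable fun k : ℕ => (k : ℝ≥0∞) ^ (-η)).comp (B.measurable_X n i)
  have hGm : ∀ k, Measurable[B.generations {n}] (G k) := fun k =>
    (measurable_id.const_mul ((k : ℝ≥0∞)⁻¹) |>.const_mul ((k : ℝ≥0∞) ^ (-η))).comp
      (@Measurable.sum_range_comp_nat _ _ (B.generations {n}) _ _ _ _
        (fun i => B.measurable_X_generations (Set.mem_singleton n) i)
        (fun j : ℕ => (j : ℝ≥0∞) ^ (-η)) k)
  refine le_trans (lintegral_mono_ae (g := fun x => G (B.Z n x) x) ?_)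
    (h.lintegral_Z_le n (g := fun k => (k : ℝ≥0∞) ^ (-η)) hGm ?_)
  · filter_upwards [h.ae_X_ne_zero] with x hx
    have hZ := Z_ne_zero hx n
    have hk : (0 : ℝ) < B.Z n x := by positivity
    have hpos : ∀ i, (0 : ℝ) < B.X n i x := fun i => by have := hx n i; positivity
    have hS : 0 < ∑ i ∈ Finset.range (B.Z n x), (B.X n i x : ℝ) :=
      Finset.sum_pos (fun i _ => hpos i) (by simpa using hZ)
    have hG' : G (B.Z n x) x = ENNReal.ofReal ((B.Z n x : ℝ) ^ (-η) *
        ((B.Z n x : ℝ)⁻¹ * ∑ i ∈ Finset.range (B.Z n x), (B.X n i x : ℝ) ^ (-η))) := by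
      simp only [hG]
      rw [ENNReal.ofReal_mul (by positivity), ENNReal.ofReal_mul (by positivity),
        ENNReal.ofReal_sum_of_nonneg fun i _ => by positivity, ENNReal.ofReal_inv_of_pos hk,
        ENNReal.ofReal_natCast, ENNReal.natCast_rpow_eq_ofReal hZ]
      simp_rw [ENNReal.natCast_rpow_eq_ofReal (hx n _)]
    rw [hG', ENNReal.natCast_rpow_eq_ofReal (Z_ne_zero hx (n + 1))]
    refine ENNReal.ofReal_le_ofReal (le_trans ?_ (Real.sum_rpow_neg_le hZ hη fun i _ => hpos i))
    -- The immigrants are dropped: they only increase `Z (n + 1)`, and the power is nonpositive.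
    refine Real.rpow_le_rpow_of_nonpos hS ?_ (by linarith)
    simp [Z]
  · intro k hk
    simp only [hG]
    rw [lintegral_const_mul _ ((Finset.measurable_fun_sum _ fun i _ => hXm i).const_mul _),
      lintegral_const_mul _ (Finset.measurable_fun_sum _ fun i _ => hXm i),
      lintegral_finsetSum _ fun i _ => hXm i]
    simp_rw [h.lintegral_X n _ fun k => (k : ℝ≥0∞) ^ (-η)]
    rw [Finset.sum_const, Finset.card_range, nsmul_eq_mul, ← mul_assoc (k : ℝ≥0∞)⁻¹,
      ENNReal.inv_mul_cancel (by exact_mod_cast hk) (ENNReal.natCast_ne_top k), one_mul, mul_comm]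
    rfl

theorem lintegral_Z_rpow_neg_le {η : ℝ} (hη : 0 ≤ η) (n : ℕ) :
    ∫⁻ x, (B.Z n x : ℝ≥0∞) ^ (-η) ∂B.quenched e ≤
      ∏ j ∈ Finset.range n, B.harmonicMoment η (e j) := by
  induction n with
  | zero => simp [Z]
  | succ n ih =>
    rw [Finset.prod_range_succ, mul_comm]
    exact (h.lintegral_Z_rpow_neg_succ_le hη n).trans (mul_le_mul_right ih _)

/-- Freezing at `k` yields the factor `k ^ (-ε)`. It is weakened to `k ^ (-η)`, as `k ≥ 1`, so that
the same harmonic moment governs all error terms. -/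
theorem lintegral_immigration_le {ε η : ℝ} (hε : 0 ≤ ε) (hηε : η ≤ ε) (n : ℕ) :
    ∫⁻ x, ((B.Y n x : ℝ≥0∞) / B.mean (e n) / B.Z n x) ^ ε ∂B.quenched e ≤
      B.immigrationMoment ε (e n) * ∫⁻ x, (B.Z n x : ℝ≥0∞) ^ (-η) ∂B.quenched e := by
  refine h.lintegral_Z_le n (G := fun k x => ((B.Y n x : ℝ≥0∞) / B.mean (e n) / k) ^ ε)
    (g := fun k => (k : ℝ≥0∞) ^ (-η)) (fun k => ?_) fun k hk => ?_
  · exact (measurable_of_countable fun j : ℕ => ((j : ℝ≥0∞) / B.mean (e n) / k) ^ ε).comp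
      (B.measurable_Y_generations (Set.mem_singleton n))
  · have hk1 : (1 : ℝ≥0∞) ≤ k := by exact_mod_cast Nat.one_le_iff_ne_zero.2 hk
    rw [h.lintegral_Y n fun j => ((j : ℝ≥0∞) / B.mean (e n) / k) ^ ε, immigrationMoment,
      ← lintegral_mul_const _ (measurable_of_countable _)]
    refine lintegral_mono fun j => ?_
    simp only
    rw [ENNReal.div_rpow_of_nonneg _ _ hε, div_eq_mul_inv, ← ENNReal.rpow_neg]
    exact mul_le_mul_right (ENNReal.rpow_le_rpow_of_exponent_le hk1 (by linarith)) _

/-- The weak law bounds the `L¹` norm by `2 * y + √y` with `y = k ^ (1 - p) * M`, and Jensen passes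
to the power `ε ≤ 1`. The square root is the slower term in `k` and fixes the exponent `(p - 1) * ε
/ 2`. -/
theorem lintegral_average_le_of_ne_zero {p ε : ℝ} (hp1 : 1 < p) (hp2 : p ≤ 2) (hε : 0 < ε)
    (hε1 : ε ≤ 1) (n : ℕ) {k : ℕ} (hk : k ≠ 0) :
    ∫⁻ x, ‖B.average n k e x - 1‖ₑ ^ ε ∂B.quenched e ≤
      (1 + 3 * B.offspringMoment p (e n) ^ ε) * (k : ℝ≥0∞) ^ (-((p - 1) * ε / 2)) := by
  have hk1 : (1 : ℝ) ≤ k := by exact_mod_cast Nat.one_le_iff_ne_zero.2 hk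
  have hk0 : (0 : ℝ) < k := by linarith
  -- If the moment is infinite, so is the right-hand side, because the power of `k` is positive.
  by_cases hM : B.offspringMoment p (e n) = ∞
  · rw [hM, ENNReal.top_rpow_of_pos hε, ENNReal.mul_top (by norm_num), add_top,
      ENNReal.natCast_rpow_eq_ofReal hk, ENNReal.top_mul]
    · exact le_top
    · rw [ne_eq, ENNReal.ofReal_eq_zero, not_le]; positivity
  set m := (B.mean (e n)).toReal with hm
  have hm1 : 1 ≤ m := h.one_le_toReal_mean n
  have hm0 : 0 < m := by linarith
  have hmE : B.mean (e n) = ENNReal.ofReal m := (ENNReal.ofReal_toReal (h.mean_ne_top n)).symm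
  set V : ℕ → Γ → ℝ := fun i x => (B.X n i x : ℝ) / m with hV
  have hVm : ∀ i, Measurable (V i) := fun i =>
    (measurable_of_countable fun j : ℕ => (j : ℝ) / m).comp (B.measurable_X n i)
  have hVpos : ∀ i x, 0 ≤ V i x := fun i x => by positivity
  have hVE : ∀ i x, ENNReal.ofReal (V i x) = (B.X n i x : ℝ≥0∞) / B.mean (e n) := fun i x => by
    rw [hmE, ENNReal.ofReal_div_of_pos hm0, ENNReal.ofReal_natCast]
  have hind : Pairwise fun i j => V i ⟂ᵢ[B.quenched e] V j := fun i j hij => by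
    have hne : (Sum.inl (n, i) : (ℕ × ℕ) ⊕ ℕ) ≠ Sum.inl (n, j) := by simpa using hij
    exact (h.indep.indepFun hne).comp (measurable_of_countable fun j : ℕ => (j : ℝ) / m)
      (measurable_of_countable fun j : ℕ => (j : ℝ) / m)
  have hid : ∀ i, IdentDistrib (V i) (V 0) (B.quenched e) (B.quenched e) := fun i => by
    have : IdentDistrib (B.X n i) (B.X n 0) (B.quenched e) (B.quenched e) :=
      ⟨(B.measurable_X n i).aemeasurable, (B.measurable_X n 0).aemeasurable, by simp [h.map_X]⟩
    exact this.comp (measurable_of_countable fun j : ℕ => (j : ℝ) / m)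
  have hV1 : ∫⁻ x, ENNReal.ofReal (V 0 x) ∂B.quenched e = 1 := by
    simp_rw [hVE]
    rw [h.lintegral_X n 0 fun j => (j : ℝ≥0∞) / B.mean (e n)]
    simp_rw [div_eq_mul_inv]
    rw [lintegral_mul_const _ (measurable_of_countable _), ← mean_eq_lintegral,
      ENNReal.mul_inv_cancel _ (h.mean_ne_top n)]
    exact (lt_of_lt_of_le one_pos (one_le_mean (h.offspring_zero n))).ne'
  have hVp : ∫⁻ x, ENNReal.ofReal (V 0 x ^ p) ∂B.quenched e = B.offspringMoment p (e n) := by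
    simp_rw [← ENNReal.ofReal_rpow_of_nonneg (hVpos 0 _) (by linarith : 0 ≤ p), hVE]
    rw [h.lintegral_X n 0 fun j => ((j : ℝ≥0∞) / B.mean (e n)) ^ p]
    rfl
  have hint : Integrable (V 0) (B.quenched e) :=
    (lintegral_ofReal_ne_top_iff_integrable (hVm 0).aestronglyMeasurable
      (ae_of_all _ (hVpos 0))).1 (by rw [hV1]; exact ENNReal.one_ne_top)
  have hone : ∫ x, V 0 x ∂B.quenched e = 1 := by
    rw [integral_eq_lintegral_of_nonneg_ae (ae_of_all _ (hVpos 0)) (hVm 0).aestronglyMeasurable,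
      hV1, ENNReal.toReal_one]
  have hVpm : AEStronglyMeasurable (fun x => V 0 x ^ p) (B.quenched e) :=
    ((hVm 0).pow_const p).aestronglyMeasurable
  have hVppos : ∀ x, 0 ≤ V 0 x ^ p := fun x => Real.rpow_nonneg (hVpos 0 x) _
  have hintp : Integrable (fun x => V 0 x ^ p) (B.quenched e) :=
    (lintegral_ofReal_ne_top_iff_integrable hVpm (ae_of_all _ hVppos)).1 (by rwa [hVp])
  set M := ∫ x, V 0 x ^ p ∂B.quenched e with hMdef
  have hM0 : 0 ≤ M := integral_nonneg hVppos
  have hME : B.offspringMoment p (e n) = ENNReal.ofReal M := by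
    rw [hMdef, ofReal_integral_eq_lintegral_ofReal hintp (ae_of_all _ hVppos), hVp]
  have hmain := integral_abs_average_sub_one_le hVm hVpos hind hid hint hone hp1 hp2 hintp hk
  rw [← hMdef] at hmain
  have havm : Measurable fun x => B.average n k e x - 1 :=
    ((Finset.measurable_fun_sum (Finset.range k) fun i _ => hVm i).const_mul _).sub_const 1
  have havi : Integrable (fun x => B.average n k e x - 1) (B.quenched e) :=
    (((integrable_finsetSum (Finset.range k) fun i _ =>
      (hid i).integrable_iff.2 hint).const_mul _).sub (integrable_const _))
  set y := (k : ℝ) ^ (1 - p) * M with hy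
  have hy0 : 0 ≤ y := by positivity
  set s := (k : ℝ) ^ (-((p - 1) * ε / 2)) with hs
  have hs0 : 0 ≤ s := by positivity
  have hMε : 0 ≤ M ^ ε := by positivity
  have h1 : (k : ℝ) ^ ((1 - p) * ε) ≤ s :=
    Real.rpow_le_rpow_of_exponent_le hk1 (by nlinarith [mul_pos (sub_pos.2 hp1) hε])
  have h2 : y ^ ε ≤ s * M ^ ε := by
    rw [hy, Real.mul_rpow (by positivity) hM0, ← Real.rpow_mul hk0.le]
    exact mul_le_mul_of_nonneg_right h1 hMε
  have h3 : √y ^ ε ≤ s * (1 + M ^ ε) := by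
    -- Only the integrability of `M ^ ε` is to be used later; this is the origin of the summand `1`
    -- in the bound.
    have hM' : M ^ (ε / 2) ≤ 1 + M ^ ε := by
      rcases le_total M 1 with h' | h'
      · linarith [Real.rpow_le_one hM0 h' (by positivity : 0 ≤ ε / 2)]
      · linarith [Real.rpow_le_rpow_of_exponent_le h' (by linarith : ε / 2 ≤ ε)]
    rw [Real.sqrt_eq_rpow, ← Real.rpow_mul hy0, hy, Real.mul_rpow (by positivity) hM0,
      ← Real.rpow_mul hk0.le, show (1 - p) * (1 / 2 * ε) = -((p - 1) * ε / 2) by ring,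
      show 1 / 2 * ε = ε / 2 by ring]
    exact mul_le_mul_of_nonneg_left hM' hs0
  have h4 : (2 * y + √y) ^ ε ≤ (1 + 3 * M ^ ε) * s := by
    have h5 := Real.rpow_add_le_add_rpow (by positivity : 0 ≤ 2 * y) (Real.sqrt_nonneg y) hε.le hε1
    rw [Real.mul_rpow (by norm_num) hy0] at h5
    have h6 : (2 : ℝ) ^ ε ≤ 2 := by
      simpa using Real.rpow_le_rpow_of_exponent_le (by norm_num : (1 : ℝ) ≤ 2) hε1
    have h7 : (2 : ℝ) ^ ε * y ^ ε ≤ 2 * (s * M ^ ε) :=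
      mul_le_mul h6 h2 (by positivity) (by norm_num)
    linarith
  calc ∫⁻ x, ‖B.average n k e x - 1‖ₑ ^ ε ∂B.quenched e
      ≤ (∫⁻ x, ‖B.average n k e x - 1‖ₑ ∂B.quenched e) ^ ε :=
        lintegral_rpow_le_rpow_lintegral havm.enorm.aemeasurable hε hε1
    _ = ENNReal.ofReal (∫ x, |B.average n k e x - 1| ∂B.quenched e) ^ ε := by
        rw [← ofReal_integral_norm_eq_lintegral_enorm havi]; rfl
    _ ≤ ENNReal.ofReal (2 * y + √y) ^ ε :=
        ENNReal.rpow_le_rpow (ENNReal.ofReal_le_ofReal hmain) hε.le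
    _ = ENNReal.ofReal ((2 * y + √y) ^ ε) :=
        ENNReal.ofReal_rpow_of_nonneg (by positivity) hε.le
    _ ≤ ENNReal.ofReal ((1 + 3 * M ^ ε) * s) := ENNReal.ofReal_le_ofReal h4
    _ = _ := by
        rw [ENNReal.ofReal_mul (by positivity), ENNReal.ofReal_add zero_le_one (by positivity),
          ENNReal.ofReal_mul (by norm_num), hME, ENNReal.natCast_rpow_eq_ofReal hk,
          ENNReal.ofReal_rpow_of_nonneg hM0 hε.le, ← hs]
        simp

theorem lintegral_average_le {p ε : ℝ} (hp1 : 1 < p) (hp2 : p ≤ 2) (hε : 0 < ε)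
    (hε1 : ε ≤ 1) (n : ℕ) :
    ∫⁻ x, ‖B.average n (B.Z n x) e x - 1‖ₑ ^ ε ∂B.quenched e ≤
      (1 + 3 * B.offspringMoment p (e n) ^ ε) *
        ∫⁻ x, (B.Z n x : ℝ≥0∞) ^ (-((p - 1) * ε / 2)) ∂B.quenched e := by
  have hG : ∀ k, Measurable[B.generations {n}] fun x => ‖B.average n k e x - 1‖ₑ ^ ε := fun k =>
    ((measurable_id.const_mul ((k : ℝ)⁻¹) |>.sub_const (1 : ℝ)).enorm.pow_const ε).comp
      (@Measurable.sum_range_comp_nat _ _ (B.generations {n}) _ _ _ _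
        (fun i => B.measurable_X_generations (Set.mem_singleton n) i)
        (fun j : ℕ => (j : ℝ) / (B.mean (e n)).toReal) k)
  exact h.lintegral_Z_le n (G := fun k x => ‖B.average n k e x - 1‖ₑ ^ ε)
    (g := fun k => (k : ℝ≥0∞) ^ (-((p - 1) * ε / 2))) hG
    fun k hk => h.lintegral_average_le_of_ne_zero hp1 hp2 hε hε1 n hk

end IsRegular

end BPIRE

/-! ### From the quenched to the annealed law. -/

theorem ENNReal.rpow_le_one_add_rpow (t : ℝ≥0∞) {a b : ℝ} (ha : 0 ≤ a) (hab : a ≤ b) :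
    t ^ a ≤ 1 + t ^ b := by
  rcases le_total t 1 with h | h
  · exact (ENNReal.rpow_le_one h ha).trans le_self_add
  · exact (ENNReal.rpow_le_rpow_of_exponent_le h hab).trans le_add_self

theorem ENNReal.tsum_geometric_ne_top {q : ℝ≥0∞} (hq : q < 1) : ∑' n : ℕ, q ^ n ≠ ∞ := by
  rw [ENNReal.tsum_geometric]
  exact ENNReal.inv_ne_top.2 (tsub_pos_of_lt hq).ne'

namespace BPIRE

variable {Θ Γ : Type*} [MeasurableSpace Θ] [MeasurableSpace Γ] (B : BPIRE Θ Γ)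

instance isProbabilityMeasure_tau : IsProbabilityMeasure B.tau := by
  unfold tau; infer_instance

theorem measurePreserving_eval (n : ℕ) :
    MeasurePreserving (fun e : ℕ → Θ => e n) B.tau B.envLaw :=
  measurePreserving_eval_infinitePi (fun _ : ℕ => B.envLaw) n

theorem ae_annealed_of_ae_tau {P : (ℕ → Θ) → Prop} (h : ∀ᵐ e ∂B.tau, P e) :
    ∀ᵐ ω ∂B.annealed, P ω.1 := by
  refine ae_of_ae_map measurable_fst.aemeasurable ?_
  have : B.annealed.map Prod.fst = B.tau := Measure.fst_compProd _ _
  rwa [this]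

theorem ae_tau_of_ae_envLaw {P : Θ → Prop} (h : ∀ᵐ θ ∂B.envLaw, P θ) :
    ∀ᵐ e ∂B.tau, ∀ n, P (e n) := by
  rw [ae_all_iff]
  exact fun n => (B.measurePreserving_eval n).quasiMeasurePreserving.ae h

theorem lintegral_annealed_fst (n : ℕ) {f : Θ → ℝ≥0∞} (hf : Measurable f) :
    ∫⁻ ω, f (ω.1 n) ∂B.annealed = ∫⁻ θ, f θ ∂B.envLaw := by
  rw [annealed, Measure.lintegral_compProd (f := fun ω : (ℕ → Θ) × Γ => f (ω.1 n))
    (hf.comp ((measurable_pi_apply n).comp measurable_fst))]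
  simp only [lintegral_const, measure_univ, mul_one]
  exact (B.measurePreserving_eval n).lintegral_comp hf

theorem ae_map_X_zero : ∀ᵐ e ∂B.tau, (B.quenched e).map (B.X 0 0) = B.offspring (e 0) := by
  filter_upwards [B.map_X] with e he using he 0 0

theorem annealed_X_zero_eq (k : ℕ) :
    B.annealed {ω | B.X 0 0 ω.2 = k} = ∫⁻ θ, B.offspring θ {k} ∂B.envLaw := by
  have hs : MeasurableSet {ω : (ℕ → Θ) × Γ | B.X 0 0 ω.2 = k} :=
    ((B.measurable_X 0 0).comp measurable_snd) (measurableSet_singleton k)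
  rw [annealed, Measure.compProd_apply hs,
    ← (B.measurePreserving_eval 0).lintegral_comp
      (B.offspring.measurable_coe (measurableSet_singleton k))]
  refine lintegral_congr_ae ?_
  filter_upwards [B.ae_map_X_zero] with e he
  rw [← he, Measure.map_apply (B.measurable_X 0 0) (measurableSet_singleton k)]
  rfl

theorem measurable_natCast_div_mean_rpow (s : ℝ) :
    Measurable fun q : Θ × ℕ => ((q.2 : ℝ≥0∞) / B.mean q.1) ^ s :=
  (((measurable_of_countable fun k : ℕ => (k : ℝ≥0∞)).comp measurable_snd).div
    (B.measurable_mean.comp measurable_fst)).pow_const s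

theorem measurable_offspringMoment (p : ℝ) : Measurable (B.offspringMoment p) :=
  (B.measurable_natCast_div_mean_rpow p).lintegral_kernel_prod_right'

theorem measurable_immigrationMoment (ε : ℝ) : Measurable (B.immigrationMoment ε) :=
  (B.measurable_natCast_div_mean_rpow ε).lintegral_kernel_prod_right'

theorem measurable_harmonicMoment (η : ℝ) : Measurable (B.harmonicMoment η) :=
  (measurable_of_countable fun k : ℕ => (k : ℝ≥0∞) ^ (-η)).lintegral_kernel

theorem measurable_log_mean : Measurable fun θ => (ENNReal.log (B.mean θ)).toENNReal :=
  (ENNReal.log_monotone.measurable.comp B.measurable_mean).ereal_toENNReal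

theorem toENNReal_log_mean {θ : Θ} (h1 : 1 ≤ B.mean θ) (h2 : B.mean θ ≠ ∞) :
    (ENNReal.log (B.mean θ)).toENNReal = ENNReal.ofReal (Real.log (B.mean θ).toReal) := by
  rw [ENNReal.log_pos_real (lt_of_lt_of_le one_pos h1).ne' h2, EReal.real_coe_toENNReal]

theorem offspringMoment_le_one_add {p p' : ℝ} (hp : 0 ≤ p') (hpp : p' ≤ p) (θ : Θ) :
    B.offspringMoment p' θ ≤ 1 + B.offspringMoment p θ := by
  calc B.offspringMoment p' θ
      ≤ ∫⁻ k : ℕ, (1 + ((k : ℝ≥0∞) / B.mean θ) ^ p) ∂B.offspring θ :=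
        lintegral_mono fun k => ENNReal.rpow_le_one_add_rpow _ hp hpp
    _ = _ := by
        rw [lintegral_add_left measurable_const, lintegral_const, measure_univ, mul_one]
        rfl

theorem immigrationMoment_le_one_add {ε δ : ℝ} (hε : 0 ≤ ε) (hεδ : ε ≤ δ) (θ : Θ) :
    B.immigrationMoment ε θ ≤ 1 + B.immigrationMoment δ θ := by
  calc B.immigrationMoment ε θ
      ≤ ∫⁻ k : ℕ, (1 + ((k : ℝ≥0∞) / B.mean θ) ^ δ) ∂B.immigration θ :=
        lintegral_mono fun k => ENNReal.rpow_le_one_add_rpow _ hε hεδ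
    _ = _ := by
        rw [lintegral_add_left measurable_const, lintegral_const, measure_univ, mul_one]
        rfl

theorem lintegral_immigrationMoment (δ : ℝ) :
    ∫⁻ ω, ((B.Y 0 ω.2 : ℝ≥0∞) / B.mean (ω.1 0)) ^ δ ∂B.annealed =
      ∫⁻ θ, B.immigrationMoment δ θ ∂B.envLaw := by
  have hm : Measurable fun ω : (ℕ → Θ) × Γ =>
      ((B.Y 0 ω.2 : ℝ≥0∞) / B.mean (ω.1 0)) ^ δ := by
    have hp : Measurable fun ω : (ℕ → Θ) × Γ => (ω.1 0, B.Y 0 ω.2) :=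
      ((measurable_pi_apply 0).comp measurable_fst).prodMk ((B.measurable_Y 0).comp measurable_snd)
    exact (B.measurable_natCast_div_mean_rpow δ).comp hp
  rw [annealed, Measure.lintegral_compProd hm,
    ← (B.measurePreserving_eval 0).lintegral_comp (B.measurable_immigrationMoment δ)]
  refine lintegral_congr_ae ?_
  filter_upwards [B.map_Y] with e he
  rw [immigrationMoment, ← he 0, lintegral_map (measurable_of_countable _) (B.measurable_Y 0)]

theorem lintegral_offspringMoment_rpow (p δ : ℝ) :
    ∫⁻ e, (∫⁻ x, ((B.X 0 0 x : ℝ≥0∞) / B.mean (e 0)) ^ p ∂B.quenched e) ^ δ ∂B.tau =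
      ∫⁻ θ, B.offspringMoment p θ ^ δ ∂B.envLaw := by
  rw [← (B.measurePreserving_eval 0).lintegral_comp
    ((B.measurable_offspringMoment p).pow_const δ)]
  refine lintegral_congr_ae ?_
  filter_upwards [B.ae_map_X_zero] with e he
  rw [offspringMoment, ← he, lintegral_map (measurable_of_countable _) (B.measurable_X 0 0)]

variable {B}

theorem ae_offspring_zero (hX0 : B.annealed {ω | B.X 0 0 ω.2 = 0} = 0) :
    ∀ᵐ θ ∂B.envLaw, B.offspring θ {0} = 0 := by
  rw [B.annealed_X_zero_eq 0,
    lintegral_eq_zero_iff (B.offspring.measurable_coe (measurableSet_singleton 0))] at hX0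
  exact hX0

/-- The extended logarithm sends `∞` to `∞`, so the finite log-moment already excludes infinite
means. -/
theorem ae_mean_ne_top {r : ℝ} (hr : 0 < r)
    (hm : ∫⁻ θ, (ENNReal.log (B.mean θ)).toENNReal ^ r ∂B.envLaw < ∞) :
    ∀ᵐ θ ∂B.envLaw, B.mean θ ≠ ∞ := by
  filter_upwards [ae_lt_top (B.measurable_log_mean.pow_const r) hm.ne] with θ hθ htop
  simp [htop, hr] at hθ

theorem ae_isRegular (hX0 : B.annealed {ω | B.X 0 0 ω.2 = 0} = 0) {r : ℝ} (hr : 0 < r)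
    (hm : ∫⁻ θ, (ENNReal.log (B.mean θ)).toENNReal ^ r ∂B.envLaw < ∞) :
    ∀ᵐ e ∂B.tau, B.IsRegular e := by
  filter_upwards [B.map_X, B.map_Y, B.indep, B.ae_tau_of_ae_envLaw (ae_offspring_zero hX0),
    B.ae_tau_of_ae_envLaw (ae_mean_ne_top hr hm)] with e h1 h2 h3 h4 h5
  exact ⟨h1, h2, h3, h4, h5⟩

/-- As `X ≥ 1`, the value `X ^ (-η)` is `1` at `X = 1` and at most `c = 2 ^ (-η) < 1` elsewhere. The
mean is thus at most `c + (1 - c) * P(X = 1)`. -/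
theorem lintegral_harmonicMoment_lt_one (hX0 : B.annealed {ω | B.X 0 0 ω.2 = 0} = 0)
    (hX1 : B.annealed {ω | B.X 0 0 ω.2 = 1} < 1) {η : ℝ} (hη : 0 < η) :
    ∫⁻ θ, B.harmonicMoment η θ ∂B.envLaw < 1 := by
  rw [B.annealed_X_zero_eq 1] at hX1
  set c : ℝ≥0∞ := 2 ^ (-η) with hc
  have hc1 : c < 1 := ENNReal.rpow_lt_one_of_one_lt_of_neg (by norm_num) (by linarith)
  have hbound : ∀ᵐ θ ∂B.envLaw, B.harmonicMoment η θ ≤ c + (1 - c) * B.offspring θ {1} := by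
    filter_upwards [ae_offspring_zero hX0] with θ hθ
    have hae : ∀ᵐ k ∂B.offspring θ, k ∉ ({0} : Set ℕ) := measure_eq_zero_iff_ae_notMem.1 hθ
    calc B.harmonicMoment η θ
        ≤ ∫⁻ k : ℕ, (c + (1 - c) * ({1} : Set ℕ).indicator 1 k) ∂B.offspring θ := by
          refine lintegral_mono_ae ?_
          filter_upwards [hae] with k hk
          rcases eq_or_ne k 1 with rfl | hk1
          · simp [add_tsub_cancel_of_le hc1.le]
          · have h2 : (2 : ℝ≥0∞) ≤ k := by
              have : 2 ≤ k := by
                have : k ≠ 0 := hk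
                omega
              exact_mod_cast this
            have h3 : (k : ℝ≥0∞) ^ (-η) ≤ c := by
              rw [hc, ENNReal.rpow_neg, ENNReal.rpow_neg, ENNReal.inv_le_inv]
              exact ENNReal.rpow_le_rpow h2 hη.le
            simpa [hk1] using h3
      _ = _ := by
          rw [lintegral_add_left measurable_const, lintegral_const, measure_univ, mul_one,
            lintegral_const_mul _ (measurable_of_countable _),
            lintegral_indicator_one (measurableSet_singleton 1)]
  refine (lintegral_mono_ae hbound).trans_lt ?_
  have hm1 := B.offspring.measurable_coe (measurableSet_singleton 1)
  rw [lintegral_add_left measurable_const, lintegral_const, measure_univ, mul_one,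
    lintegral_const_mul _ hm1]
  calc c + (1 - c) * ∫⁻ θ, B.offspring θ {1} ∂B.envLaw < c + (1 - c) * 1 := by
        refine ENNReal.add_lt_add_left hc1.ne_top ?_
        exact (ENNReal.mul_lt_mul_iff_right (tsub_pos_of_lt hc1).ne'
          (ne_top_of_le_ne_top ENNReal.one_ne_top tsub_le_self)).2 hX1
    _ = 1 := by rw [mul_one, add_tsub_cancel_of_le hc1.le]

variable (B) in
theorem measurable_average (n : ℕ) :
    Measurable fun ω : (ℕ → Θ) × Γ => B.average n (B.Z n ω.2) ω.1 ω.2 := by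
  have h1 : Measurable fun ω : (ℕ → Θ) × Γ =>
      ∑ i ∈ Finset.range (B.Z n ω.2), B.X n i ω.2 := by
    have := Measurable.add_sum_range_nat (Ω := Γ) (measurable_const (a := 0)) (B.measurable_Z n)
      (B.measurable_X n)
    simp only [zero_add] at this
    exact this.comp measurable_snd
  have hcast : Measurable fun k : ℕ => (k : ℝ) := measurable_of_countable _
  have h2 : Measurable fun ω : (ℕ → Θ) × Γ => (B.mean (ω.1 n)).toReal :=
    (B.measurable_mean.comp ((measurable_pi_apply n).comp measurable_fst)).ennreal_toReal
  have h3 : Measurable fun ω : (ℕ → Θ) × Γ => (B.Z n ω.2 : ℝ) :=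
    hcast.comp ((B.measurable_Z n).comp measurable_snd)
  simp only [average, ← Finset.sum_div, ← Nat.cast_sum]
  exact h3.inv.mul ((hcast.comp h1).div h2)

variable (B) in
theorem measurable_immigration_div (ε : ℝ) (n : ℕ) : Measurable fun ω : (ℕ → Θ) × Γ =>
    ((B.Y n ω.2 : ℝ≥0∞) / B.mean (ω.1 n) / B.Z n ω.2) ^ ε := by
  have hcast : Measurable fun k : ℕ => (k : ℝ≥0∞) := measurable_of_countable _
  exact (((hcast.comp ((B.measurable_Y n).comp measurable_snd)).div
    (B.measurable_mean.comp ((measurable_pi_apply n).comp measurable_fst))).div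
      (hcast.comp ((B.measurable_Z n).comp measurable_snd))).pow_const ε

/-- A quenched bound in terms of a harmonic moment of `Z n` gives a geometric annealed bound. -/
theorem lintegral_annealed_le (hreg : ∀ᵐ e ∂B.tau, B.IsRegular e) {η : ℝ} (hη : 0 ≤ η) (n : ℕ)
    {F : (ℕ → Θ) × Γ → ℝ≥0∞} (hF : Measurable F) {b : Θ → ℝ≥0∞} (hb : Measurable b)
    (hle : ∀ e, B.IsRegular e → ∫⁻ x, F (e, x) ∂B.quenched e ≤
      b (e n) * ∫⁻ x, (B.Z n x : ℝ≥0∞) ^ (-η) ∂B.quenched e) :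
    ∫⁻ ω, F ω ∂B.annealed ≤
      (∫⁻ θ, B.harmonicMoment η θ ∂B.envLaw) ^ n * ∫⁻ θ, b θ ∂B.envLaw := by
  rw [annealed, Measure.lintegral_compProd hF,
    ← lintegral_prod_mul_infinitePi B.envLaw (B.measurable_harmonicMoment η) hb n]
  refine lintegral_mono_ae ?_
  filter_upwards [hreg] with e he
  refine (hle e he).trans ?_
  rw [mul_comm]
  exact mul_le_mul_left (he.lintegral_Z_rpow_neg_le hη n) _

end BPIRE

/-! ### The increments of `log W`. -/

namespace BPIRE

variable {Θ Γ : Type*} [MeasurableSpace Θ] [MeasurableSpace Γ] {B : BPIRE Θ Γ}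

variable (B) in
theorem measurable_W (n : ℕ) : Measurable (B.W n) := by
  have h1 : Measurable fun ω : (ℕ → Θ) × Γ => (B.Z n ω.2 : ℝ) :=
    (measurable_of_countable fun k : ℕ => (k : ℝ)).comp ((B.measurable_Z n).comp measurable_snd)
  have h2 : Measurable fun ω : (ℕ → Θ) × Γ => B.Pi n ω.1 :=
    Finset.measurable_fun_prod _ fun k _ =>
      (B.measurable_mean.comp ((measurable_pi_apply k).comp measurable_fst)).ennreal_toReal
  exact h1.div h2

variable (B) in
/-- The event that the average of the offspring numbers is far from its mean. -/
noncomputable def deviation (n : ℕ) (ω : (ℕ → Θ) × Γ) : ℝ≥0∞ :=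
  if 1 / 2 < |B.average n (B.Z n ω.2) ω.1 ω.2 - 1| then 1 else 0

variable (B) in
theorem measurable_deviation (n : ℕ) : Measurable (B.deviation n) :=
  Measurable.ite (measurableSet_lt measurable_const
    (continuous_abs.measurable.comp ((B.measurable_average n).sub_const 1)))
    measurable_const measurable_const

/-- A Markov-type bound: `t > 1 / 2` implies `t ^ ε ≥ 1 / 2` when `0 < ε ≤ 1`. -/
theorem deviation_le {ε : ℝ} (hε : 0 < ε) (hε1 : ε ≤ 1) (n : ℕ) (ω : (ℕ → Θ) × Γ) :
    B.deviation n ω ≤ 2 * ‖B.average n (B.Z n ω.2) ω.1 ω.2 - 1‖ₑ ^ ε := by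
  unfold deviation
  split_ifs with hd
  · set a := B.average n (B.Z n ω.2) ω.1 ω.2 - 1
    have h1 : (1 / 2 : ℝ) ≤ |a| ^ ε := by
      rcases le_total |a| 1 with h | h
      · have := Real.rpow_le_rpow_of_exponent_ge' (abs_nonneg a) h hε.le hε1
        rw [Real.rpow_one] at this
        linarith
      · linarith [Real.one_le_rpow h hε.le]
    rw [Real.enorm_eq_ofReal_abs, ENNReal.ofReal_rpow_of_nonneg (abs_nonneg _) hε.le,
      ← ENNReal.ofReal_ofNat 2, ← ENNReal.ofReal_mul (by norm_num), ENNReal.one_le_ofReal]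
    linarith
  · exact zero_le

theorem IsRegular.Pi_pos {e : ℕ → Θ} (h : B.IsRegular e) (n : ℕ) : 0 < B.Pi n e :=
  Finset.prod_pos fun k _ => lt_of_lt_of_le one_pos (h.one_le_toReal_mean k)

theorem IsRegular.W_pos {e : ℕ → Θ} (h : B.IsRegular e) {x : Γ} (hx : ∀ n i, B.X n i x ≠ 0)
    (n : ℕ) : 0 < B.W n (e, x) :=
  div_pos (by exact_mod_cast Nat.pos_of_ne_zero (Z_ne_zero hx n)) (h.Pi_pos n)

theorem IsRegular.enorm_log_W_sub_le {e : ℕ → Θ} (h : B.IsRegular e) {x : Γ}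
    (hx : ∀ n i, B.X n i x ≠ 0) {ε : ℝ} (hε : 0 < ε) (hε1 : ε ≤ 1) (n : ℕ) :
    ‖Real.log (B.W (n + 1) (e, x)) - Real.log (B.W n (e, x))‖ₑ ≤
      ENNReal.ofReal (2 / ε) * (‖B.average n (B.Z n x) e x - 1‖ₑ ^ ε +
        ((B.Y n x : ℝ≥0∞) / B.mean (e n) / B.Z n x) ^ ε) +
      (ENNReal.log (B.mean (e n))).toENNReal * B.deviation n (e, x) := by
  set m := (B.mean (e n)).toReal with hm
  have hm1 : 1 ≤ m := h.one_le_toReal_mean n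
  have hm0 : 0 < m := by linarith
  have hmE : B.mean (e n) = ENNReal.ofReal m := (ENNReal.ofReal_toReal (h.mean_ne_top n)).symm
  have hZ : (0 : ℝ) < B.Z n x := by exact_mod_cast Nat.pos_of_ne_zero (Z_ne_zero hx n)
  have hP := h.Pi_pos n
  set a := B.average n (B.Z n x) e x with ha
  set y := (B.Y n x : ℝ) / m / B.Z n x with hy
  have hy0 : 0 ≤ y := by positivity
  have haeq : a = (∑ i ∈ Finset.range (B.Z n x), (B.X n i x : ℝ)) / m / B.Z n x := by
    rw [ha, average, ← Finset.sum_div, div_eq_inv_mul _ (B.Z n x : ℝ)]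
  have hma : m⁻¹ ≤ a := by
    have h1 : (B.Z n x : ℝ) ≤ ∑ i ∈ Finset.range (B.Z n x), (B.X n i x : ℝ) := by
      have h2 : ∀ i ∈ Finset.range (B.Z n x), (1 : ℝ) ≤ B.X n i x := fun i _ => by
        exact_mod_cast Nat.one_le_iff_ne_zero.2 (hx n i)
      simpa using Finset.sum_le_sum h2
    rw [haeq, le_div_iff₀ hZ, inv_mul_eq_div]
    gcongr
  -- The multiplicative recursion that turns increments of `log W` into `log (a + y)`.
  have hW : B.W (n + 1) (e, x) = B.W n (e, x) * (a + y) := by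
    have hPi : B.Pi (n + 1) e = B.Pi n e * m := Finset.prod_range_succ _ _
    simp only [W, hPi, Z, haeq, hy]
    push_cast
    field_simp
    ring
  have ha0 : 0 < a + y := add_pos_of_pos_of_nonneg (lt_of_lt_of_le (by positivity) hma) hy0
  have hdiff : Real.log (B.W (n + 1) (e, x)) - Real.log (B.W n (e, x)) = Real.log (a + y) := by
    rw [hW, Real.log_mul (h.W_pos hx n).ne' ha0.ne']
    ring
  have hyE : ((B.Y n x : ℝ≥0∞) / B.mean (e n) / B.Z n x) ^ ε = ENNReal.ofReal (y ^ ε) := by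
    rw [← ENNReal.ofReal_rpow_of_nonneg hy0 hε.le, hy, ENNReal.ofReal_div_of_pos hZ,
      ENNReal.ofReal_div_of_pos hm0, ENNReal.ofReal_natCast, ENNReal.ofReal_natCast, hmE]
  have hlast : (ENNReal.log (B.mean (e n))).toENNReal * B.deviation n (e, x) =
      ENNReal.ofReal (if 1 / 2 < |a - 1| then Real.log m else 0) := by
    rw [B.toENNReal_log_mean (one_le_mean (h.offspring_zero n)) (h.mean_ne_top n)]
    simp only [deviation, ← ha, ← hm]
    split_ifs <;> simp
  have hite : 0 ≤ if 1 / 2 < |a - 1| then Real.log m else 0 := by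
    split_ifs <;> simp [Real.log_nonneg hm1]
  rw [hdiff, hyE, hlast, Real.enorm_eq_ofReal_abs, Real.enorm_eq_ofReal_abs,
    ENNReal.ofReal_rpow_of_nonneg (abs_nonneg _) hε.le,
    ← ENNReal.ofReal_add (by positivity) (by positivity), ← ENNReal.ofReal_mul (by positivity),
    ← ENNReal.ofReal_add (by positivity) hite]
  exact ENNReal.ofReal_le_ofReal (Real.abs_log_add_le hm1 hma hy0 hε hε1)

theorem ae_X_ne_zero (hreg : ∀ᵐ e ∂B.tau, B.IsRegular e) :
    ∀ᵐ ω ∂B.annealed, ∀ n i, B.X n i ω.2 ≠ 0 := by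
  refine Measure.ae_compProd_of_ae_ae ?_ ?_
  · simp only [Set.ofPred_forall]
    exact MeasurableSet.iInter fun n => MeasurableSet.iInter fun i =>
      (((B.measurable_X n i).comp measurable_snd) (measurableSet_singleton 0)).compl
  · filter_upwards [hreg] with e he using he.ae_X_ne_zero

instance isProbabilityMeasure_annealed : IsProbabilityMeasure B.annealed := by
  unfold annealed; infer_instance

/-- The increments of `log W` are summable in `L¹`. -/
theorem tsum_lintegral_log_W_sub_ne_top (hreg : ∀ᵐ e ∂B.tau, B.IsRegular e)
    {r p ε : ℝ} (hr : 1 < r) (hp1 : 1 < p) (hp2 : p ≤ 2) (hε : 0 < ε) (hε1 : ε ≤ 1)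
    (hρ : ∫⁻ θ, B.harmonicMoment ((p - 1) * ε / 2) θ ∂B.envLaw < 1)
    (hY : ∫⁻ θ, B.immigrationMoment ε θ ∂B.envLaw ≠ ∞)
    (hm : ∫⁻ θ, (ENNReal.log (B.mean θ)).toENNReal ^ r ∂B.envLaw ≠ ∞)
    (hX : ∫⁻ θ, B.offspringMoment p θ ^ ε ∂B.envLaw ≠ ∞) :
    ∑' n, ∫⁻ ω, ‖Real.log (B.W (n + 1) ω) - Real.log (B.W n ω)‖ₑ ∂B.annealed ≠ ∞ := by
  set η := (p - 1) * ε / 2 with hη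
  have hη0 : 0 ≤ η := by have := mul_pos (sub_pos.2 hp1) hε; positivity
  -- This uses `p ≤ 2`.
  have hηε : η ≤ ε := by nlinarith
  set ρ := ∫⁻ θ, B.harmonicMoment η θ ∂B.envLaw with hρdef
  have hbm : Measurable fun θ => 1 + 3 * B.offspringMoment p θ ^ ε :=
    (((B.measurable_offspringMoment p).pow_const ε).const_mul 3).const_add 1
  set C := ∫⁻ θ, (1 + 3 * B.offspringMoment p θ ^ ε) ∂B.envLaw with hC
  have hC' : C ≠ ∞ := by
    rw [hC, lintegral_add_left measurable_const, lintegral_const, measure_univ, mul_one,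
      lintegral_const_mul _ ((B.measurable_offspringMoment p).pow_const ε)]
    exact ENNReal.add_ne_top.2 ⟨ENNReal.one_ne_top, ENNReal.mul_ne_top (by norm_num) hX⟩
  set D := ∫⁻ θ, B.immigrationMoment ε θ ∂B.envLaw with hD
  set K := ∫⁻ θ, (ENNReal.log (B.mean θ)).toENNReal ^ r ∂B.envLaw with hK
  have hAm : ∀ n, Measurable fun ω : (ℕ → Θ) × Γ =>
      ‖B.average n (B.Z n ω.2) ω.1 ω.2 - 1‖ₑ ^ ε := fun n =>
    ((B.measurable_average n).sub_const 1).enorm.pow_const ε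
  have hA : ∀ n, ∫⁻ ω, ‖B.average n (B.Z n ω.2) ω.1 ω.2 - 1‖ₑ ^ ε ∂B.annealed ≤ ρ ^ n * C :=
    fun n => lintegral_annealed_le hreg hη0 n (hAm n) hbm fun e he =>
      he.lintegral_average_le hp1 hp2 hε hε1 n
  have hI : ∀ n, ∫⁻ ω, ((B.Y n ω.2 : ℝ≥0∞) / B.mean (ω.1 n) / B.Z n ω.2) ^ ε ∂B.annealed ≤
      ρ ^ n * D :=
    fun n => lintegral_annealed_le hreg hη0 n (B.measurable_immigration_div ε n)
      (B.measurable_immigrationMoment ε) fun e he => he.lintegral_immigration_le hε.le hηε n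
  obtain ⟨q, hrq⟩ : ∃ q, r.HolderConjugate q := ⟨_, Real.HolderConjugate.conjExponent hr⟩
  have hq := hrq.symm.pos
  have hLm : ∀ n, Measurable fun ω : (ℕ → Θ) × Γ => (ENNReal.log (B.mean (ω.1 n))).toENNReal :=
    fun n => B.measurable_log_mean.comp ((measurable_pi_apply n).comp measurable_fst)
  have hL : ∀ n, ∫⁻ ω, (ENNReal.log (B.mean (ω.1 n))).toENNReal * B.deviation n ω ∂B.annealed ≤
      K ^ (1 / r) * (2 * C) ^ (1 / q) * (ρ ^ (1 / q)) ^ n := by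
    intro n
    have h1 := ENNReal.lintegral_mul_le_Lp_mul_Lq B.annealed hrq (hLm n).aemeasurable
      (B.measurable_deviation n).aemeasurable
    -- An indicator equals its `q`-th power, so Hölder costs only the root `1 / q`: the ratio
    -- becomes `ρ ^ (1 / q)`, still below `1`.
    have h2 : ∫⁻ ω, B.deviation n ω ^ q ∂B.annealed ≤ ρ ^ n * (2 * C) := by
      calc ∫⁻ ω, B.deviation n ω ^ q ∂B.annealed
          ≤ ∫⁻ ω, 2 * ‖B.average n (B.Z n ω.2) ω.1 ω.2 - 1‖ₑ ^ ε ∂B.annealed := by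
            refine lintegral_mono fun ω => le_trans (le_of_eq ?_) (deviation_le hε hε1 n ω)
            simp only [deviation]
            split_ifs <;> simp [hq]
        _ ≤ 2 * (ρ ^ n * C) := by
            rw [lintegral_const_mul _ (hAm n)]
            exact mul_le_mul_right (hA n) _
        _ = _ := by ring
    rw [B.lintegral_annealed_fst n (B.measurable_log_mean.pow_const r), ← hK] at h1
    refine h1.trans ?_
    have h3 : (ρ ^ (1 / q)) ^ n = (ρ ^ n) ^ (1 / q) := by
      rw [← ENNReal.rpow_natCast, ← ENNReal.rpow_natCast, ← ENNReal.rpow_mul, ← ENNReal.rpow_mul,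
        mul_comm]
    rw [h3, mul_assoc, mul_comm ((2 * C) ^ (1 / q)),
      ← ENNReal.mul_rpow_of_nonneg _ _ (by positivity : 0 ≤ 1 / q)]
    exact mul_le_mul_right (ENNReal.rpow_le_rpow h2 (by positivity)) _
  have hstep : ∀ n, ∫⁻ ω, ‖Real.log (B.W (n + 1) ω) - Real.log (B.W n ω)‖ₑ ∂B.annealed ≤
      ENNReal.ofReal (2 / ε) * (C + D) * ρ ^ n +
        K ^ (1 / r) * (2 * C) ^ (1 / q) * (ρ ^ (1 / q)) ^ n := by
    intro n
    have hae : ∀ᵐ ω ∂B.annealed, ‖Real.log (B.W (n + 1) ω) - Real.log (B.W n ω)‖ₑ ≤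
        ENNReal.ofReal (2 / ε) * (‖B.average n (B.Z n ω.2) ω.1 ω.2 - 1‖ₑ ^ ε +
          ((B.Y n ω.2 : ℝ≥0∞) / B.mean (ω.1 n) / B.Z n ω.2) ^ ε) +
        (ENNReal.log (B.mean (ω.1 n))).toENNReal * B.deviation n ω := by
      filter_upwards [B.ae_annealed_of_ae_tau hreg, ae_X_ne_zero hreg] with ω h1 h2
      exact h1.enorm_log_W_sub_le h2 hε hε1 n
    refine (lintegral_mono_ae hae).trans ?_
    have hLdm : Measurable fun ω : (ℕ → Θ) × Γ =>
        (ENNReal.log (B.mean (ω.1 n))).toENNReal * B.deviation n ω :=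
      (hLm n).mul (B.measurable_deviation n)
    rw [lintegral_add_right _ hLdm, lintegral_const_mul' _ _ ENNReal.ofReal_ne_top,
      lintegral_add_left (hAm n)]
    refine add_le_add ?_ (hL n)
    calc _ ≤ ENNReal.ofReal (2 / ε) * (ρ ^ n * C + ρ ^ n * D) :=
          mul_le_mul_right (add_le_add (hA n) (hI n)) _
      _ = _ := by ring
  refine ne_top_of_le_ne_top ?_ (ENNReal.tsum_le_tsum hstep)
  have hρq : ρ ^ (1 / q) < 1 := ENNReal.rpow_lt_one hρ (by positivity)
  have hr0 : 0 ≤ 1 / r := by positivity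
  have hq0 : 0 ≤ 1 / q := by positivity
  rw [ENNReal.tsum_add, ENNReal.tsum_mul_left, ENNReal.tsum_mul_left]
  refine ENNReal.add_ne_top.2 ⟨ENNReal.mul_ne_top (ENNReal.mul_ne_top ENNReal.ofReal_ne_top
    (ENNReal.add_ne_top.2 ⟨hC', hY⟩)) (ENNReal.tsum_geometric_ne_top hρ), ENNReal.mul_ne_top
    (ENNReal.mul_ne_top (ENNReal.rpow_ne_top_of_nonneg hr0 hm)
      (ENNReal.rpow_ne_top_of_nonneg hq0 (ENNReal.mul_ne_top (by norm_num) hC')))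
    (ENNReal.tsum_geometric_ne_top hρq)⟩

end BPIRE

/-! ### Conclusion. -/

theorem corollary3p1 {Θ Γ : Type*} [MeasurableSpace Θ] [MeasurableSpace Γ] (B : BPIRE Θ Γ)
    (hX0 : B.annealed {ω | B.X 0 0 ω.2 = 0} = 0)
    (hX1 : B.annealed {ω | B.X 0 0 ω.2 = 1} < 1)
    (r p δ : ℝ) (hr : 1 < r) (hp : 1 < p) (hδ : 0 < δ)
    (hY : ∫⁻ ω, ((B.Y 0 ω.2 : ℝ≥0∞) / B.mean (ω.1 0)) ^ δ ∂B.annealed < ∞)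
    (hm : ∫⁻ ω, (ENNReal.log (B.mean (ω.1 0))).toENNReal ^ r ∂B.annealed < ∞)
    (hX : ∫⁻ e, (∫⁻ x, ((B.X 0 0 x : ℝ≥0∞) / B.mean (e 0)) ^ p ∂B.quenched e) ^ δ ∂B.tau < ∞) :
    (∀ᵐ ω ∂B.annealed, Tendsto (fun n => B.W n ω) atTop (𝓝 (B.Wlim ω))) ∧
    (∀ᵐ ω ∂B.annealed, 0 < B.Wlim ω) ∧
    (∀ n, Integrable (fun ω => Real.log (B.W n ω)) B.annealed) ∧
    Integrable (fun ω => Real.log (B.Wlim ω)) B.annealed ∧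
    Tendsto (fun n => ∫ ω, Real.log (B.W n ω) ∂B.annealed) atTop
      (𝓝 (∫ ω, Real.log (B.Wlim ω) ∂B.annealed)) ∧
    Tendsto (fun n => eLpNorm (fun ω => Real.log (B.W n ω) - Real.log (B.Wlim ω)) 1 B.annealed)
      atTop (𝓝 0) := by
  rw [B.lintegral_immigrationMoment] at hY
  rw [B.lintegral_annealed_fst 0 (B.measurable_log_mean.pow_const r)] at hm
  rw [B.lintegral_offspringMoment_rpow] at hX
  have hreg := BPIRE.ae_isRegular hX0 (by linarith) hm
  -- Lowering `δ` to at most `1` and `p` to at most `2` loses nothing: `t ^ a ≤ 1 + t ^ b` for `0 ≤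
  -- a ≤ b` carries the moment conditions over.
  set ε := min δ 1 with hεdef
  set p' := min p 2 with hpdef
  have hε : 0 < ε := lt_min hδ one_pos
  have hε1 : ε ≤ 1 := min_le_right _ _
  have hεδ : ε ≤ δ := min_le_left _ _
  have hp1 : 1 < p' := lt_min hp (by norm_num)
  have hη : 0 < (p' - 1) * ε / 2 := by have := mul_pos (sub_pos.2 hp1) hε; positivity
  have hY' : ∫⁻ θ, B.immigrationMoment ε θ ∂B.envLaw ≠ ∞ := by
    refine ne_top_of_le_ne_top ?_
      (lintegral_mono fun θ => B.immigrationMoment_le_one_add hε.le hεδ θ)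
    rw [lintegral_add_left measurable_const, lintegral_const, measure_univ, mul_one]
    exact ENNReal.add_ne_top.2 ⟨ENNReal.one_ne_top, hY.ne⟩
  have hX' : ∫⁻ θ, B.offspringMoment p' θ ^ ε ∂B.envLaw ≠ ∞ := by
    have hle : ∀ θ, B.offspringMoment p' θ ^ ε ≤ 2 + B.offspringMoment p θ ^ δ := fun θ =>
      calc B.offspringMoment p' θ ^ ε ≤ (1 + B.offspringMoment p θ) ^ ε :=
            ENNReal.rpow_le_rpow
              (B.offspringMoment_le_one_add (by linarith) (min_le_left _ _) θ) hε.le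
        _ ≤ 1 ^ ε + B.offspringMoment p θ ^ ε := ENNReal.rpow_add_le_add_rpow _ _ hε.le hε1
        _ ≤ 1 + (1 + B.offspringMoment p θ ^ δ) := by
            rw [ENNReal.one_rpow]
            gcongr
            exact ENNReal.rpow_le_one_add_rpow _ hε.le hεδ
        _ = _ := by rw [← add_assoc, one_add_one_eq_two]
    refine ne_top_of_le_ne_top ?_ (lintegral_mono hle)
    rw [lintegral_add_left measurable_const, lintegral_const, measure_univ, mul_one]
    exact ENNReal.add_ne_top.2 ⟨ENNReal.ofNat_ne_top, hX.ne⟩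
  have hsum := BPIRE.tsum_lintegral_log_W_sub_ne_top hreg hr hp1 (min_le_right _ _) hε hε1
    (BPIRE.lintegral_harmonicMoment_lt_one hX0 hX1 hη) hY' hm.ne hX'
  -- The initial term is integrable because `W 0 = 1`, so `log (W 0) = 0`.
  obtain ⟨g, hlim, hint, hgint, hL1⟩ := exists_tendsto_of_tsum_lintegral_ne_top
    (f := fun n ω => Real.log (B.W n ω))
    (fun n => Real.measurable_log.comp (B.measurable_W n)) (by simp [BPIRE.W, BPIRE.Z, BPIRE.Pi])
    hsum
  have hW : ∀ᵐ ω ∂B.annealed, Tendsto (fun n => B.W n ω) atTop (𝓝 (Real.exp (g ω))) := by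
    filter_upwards [hlim, B.ae_annealed_of_ae_tau hreg, BPIRE.ae_X_ne_zero hreg] with ω h1 h2 h3
    refine (Real.continuous_exp.continuousAt.tendsto.comp h1).congr fun n => ?_
    exact Real.exp_log (h2.W_pos h3 n)
  -- `limUnder` has an arbitrary value off the convergence set, so the identification holds only
  -- almost everywhere, which suffices.
  have hWlim : ∀ᵐ ω ∂B.annealed, B.Wlim ω = Real.exp (g ω) := by
    filter_upwards [hW] with ω hω using hω.limUnder_eq
  have hlog : (fun ω => Real.log (B.Wlim ω)) =ᵐ[B.annealed] g := by
    filter_upwards [hWlim] with ω hω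
    rw [hω, Real.log_exp]
  have hL1' : Tendsto (fun n => eLpNorm (fun ω => Real.log (B.W n ω) - Real.log (B.Wlim ω)) 1
      B.annealed) atTop (𝓝 0) := by
    refine hL1.congr fun n => eLpNorm_congr_ae ?_
    filter_upwards [hlog] with ω hω
    rw [hω]
  refine ⟨?_, ?_, hint, hgint.congr hlog.symm, ?_, hL1'⟩
  · filter_upwards [hW, hWlim] with ω h1 h2
    rwa [h2]
  · filter_upwards [hWlim] with ω h
    rw [h]
    exact Real.exp_pos _
  · exact tendsto_integral_of_L1' _ (hgint.congr hlog.symm).aestronglyMeasurable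
      (Eventually.of_forall hint) hL1'
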